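/- Let $d\ge 1$, let $\mathcal S=\{x\in[0,1]^d:\ \|x\|_1\le 1\}$ with $\|x\|_1=\sum_{i=1}^d|x_i|$, and let $F$ be the joint cumulative distribution function of a probability law on $\mathbb R^d$ such that $F$ is twice continuously differentiable on $\mathcal S$. Let $X_1,X_2,\dots$ be independent random vectors with c.d.f. $F$, let $F_n(x)=n^{-1}\sum_{i=1}^n \mathbf 1_{(-\infty,x]}(X_i)$ be the empirical c.d.f., and for integers $m,n\ge 1$ let $$F^\star_{n,m}(x)=\sum_{k\in\mathbb N_0^d,\ \|k\|_1\le m}F_n(k/m)\,P_{k,m}(x),\qquad P_{k,m}(x)=\frac{m!}{(m-\|k\|_1)!\prod_{i=1}^d k_i!}\,(1-\|x\|_1)^{m-\|k\|_1}\prod_{i=1}^d x_i^{k_i},\qquad x\in\mathcal S,$$ be the Bernstein estimator of $F$, with $\mathrm{MISE}[F^\star_{n,m}]=\mathbb E\int_{\mathcal S}|F^\star_{n,m}(x)-F(x)|^2\,dx$. Put $$\sigma^2(x)=F(x)(1-F(x)),\quad V(x)=\sum_{i=1}^d\frac{\partial F}{\partial x_i}(x)\sqrt{\frac{x_i(1-x_i)}{\pi}},\quad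 B(x)=\frac12\sum_{i,j=1}^d\big(x_i\mathbf 1_{\{i=j\}}-x_ix_j\big)\frac{\partial^2F}{\partial x_i\partial x_j}(x).$$ **Theorem (Mean integrated squared error).** For every sequence of positive integers $m=m(n)\to\infty$, as $n\to\infty$, $$\mathrm{MISE}[F^\star_{n,m}]=n^{-1}\int_{\mathcal S}\sigma^2\,dx-n^{-1}m^{-1/2}\int_{\mathcal S}V\,dx+m^{-2}\int_{\mathcal S}B^2\,dx+o(n^{-1}m^{-1/2})+o(m^{-2}).$$ In particular, if $\int_{\mathcal S}B^2\,dx>0$, then $\int_{\mathcal S}V\,dx>0$ and the asymptotically optimal choice of $m$ with respect to MISE is $$m_{\mathrm{opt}}=m_{\mathrm{opt}}(n)=n^{2/3}\left[\frac{4\int_{\mathcal S}B^2\,dx}{\int_{\mathcal S}V\,dx}\right]^{2/3},$$ in the following sense. For every $n\ge1$, $m_{\mathrm{opt}}$ is the unique minimizer over real $m>0$ of the sum of the three explicit terms above; and a sequence of positive integers $m(n)$ satisfies $\mathrm{MISE}[F^\star_{n,m(n)}]\le\mathrm{MISE}[F^\star_{n,m'(n)}]+o(n^{-4/3})$ for every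 sequence of positive integers $m'(n)$ if and only if $m(n)/m_{\mathrm{opt}}(n)\to1$. For every integer sequence with $m(n)/m_{\mathrm{opt}}(n)\to1$ (for instance $m_{\mathrm{opt}}$ rounded to an integer), $$\mathrm{MISE}[F^\star_{n,m(n)}]=n^{-1}\int_{\mathcal S}\sigma^2\,dx-n^{-4/3}\,\frac34\left[\frac{\big(\int_{\mathcal S}V\,dx\big)^4}{4\int_{\mathcal S}B^2\,dx}\right]^{1/3}+o(n^{-4/3}),\qquad n\to\infty.$$ -/

import Mathlib

open MeasureTheory ProbabilityTheory Filter Topology Asymptotics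

namespace BernsteinSimplex

noncomputable section

/-- The `ℓ¹` norm on `ℝ^d`. -/
def norm1 {d : ℕ} (x : Fin d → ℝ) : ℝ := ∑ i, |x i|

/-- The `d`-dimensional unit simplex `{x ∈ [0,1]^d : ‖x‖₁ ≤ 1}`. -/
def simplex (d : ℕ) : Set (Fin d → ℝ) :=
  {x | (∀ i, x i ∈ Set.Icc (0 : ℝ) 1) ∧ norm1 x ≤ 1}

/-- The joint cumulative distribution function `F(x) = μ((-∞, x])` of a law `μ` on `ℝ^d`
(`Set.Iic x` is the orthant of all `y` with `y i ≤ x i` for every `i`). -/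
def jointCDF {d : ℕ} (μ : Measure (Fin d → ℝ)) (x : Fin d → ℝ) : ℝ := μ.real (Set.Iic x)

/-- The multi-indices `k ∈ ℕ₀^d` with `‖k‖₁ ≤ m`, that is `ℕ₀^d ∩ m 𝒮`. -/
def multiIndices (d m : ℕ) : Finset (Fin d → ℕ) :=
  (Fintype.piFinset fun _ => Finset.range (m + 1)).filter fun k => ∑ i, k i ≤ m

/-- The multinomial probability `P_{k,m}(x)`. -/
def multinomialWeight {d : ℕ} (m : ℕ) (k : Fin d → ℕ) (x : Fin d → ℝ) : ℝ :=
  (m.factorial : ℝ) / (((m - ∑ i, k i).factorial : ℝ) * ∏ i, ((k i).factorial : ℝ))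
    * (1 - norm1 x) ^ (m - ∑ i, k i) * ∏ i, x i ^ k i

/-- The Bernstein polynomial of order `m` on the simplex for a function `G`. -/
def bernsteinPoly {d : ℕ} (G : (Fin d → ℝ) → ℝ) (m : ℕ) (x : Fin d → ℝ) : ℝ :=
  ∑ k ∈ multiIndices d m, G (fun i => (k i : ℝ) / (m : ℝ)) * multinomialWeight m k x

/-- The empirical c.d.f. of the first `n` members of a sequence of points `z`. -/
def empiricalCDF {d : ℕ} (z : ℕ → Fin d → ℝ) (n : ℕ) (x : Fin d → ℝ) : ℝ :=
  (n : ℝ)⁻¹ * ∑ i ∈ Finset.range n, (Set.Iic x).indicator (fun _ => (1 : ℝ)) (z i)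

/-- The Bernstein c.d.f. estimator `F*_{n,m}`: the Bernstein polynomial of order `m` for the
empirical c.d.f. of `n` observations. -/
def bernsteinEstimator {d : ℕ} (z : ℕ → Fin d → ℝ) (n m : ℕ) (x : Fin d → ℝ) : ℝ :=
  bernsteinPoly (empiricalCDF z n) m x

/-- Mean integrated squared error over the simplex of the estimator `F*_{n,m}` of `F`,
`MISE = 𝔼 ∫_𝒮 |F*_{n,m}(x) - F(x)|² dx`. -/
def MISE {d : ℕ} {Ω : Type*} [MeasurableSpace Ω] (P : Measure Ω) (X : ℕ → Ω → Fin d → ℝ)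
    (F : (Fin d → ℝ) → ℝ) (n m : ℕ) : ℝ :=
  ∫ ω, (∫ x in simplex d, (bernsteinEstimator (fun i => X i ω) n m x - F x) ^ 2) ∂P

/-- The partial derivative `∂G/∂x_i` relative to the simplex (at interior points this is the
ordinary partial derivative; at boundary points it is the one determined by `G` on the simplex). -/
def partialDeriv {d : ℕ} (i : Fin d) (G : (Fin d → ℝ) → ℝ) (x : Fin d → ℝ) : ℝ :=
  fderivWithin ℝ G (simplex d) x (Pi.single i 1)

/-- `B(x) = ½ ∑_{i,j} (x_i 1_{i=j} - x_i x_j) ∂²F/∂x_i∂x_j (x)`. -/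
def biasTerm {d : ℕ} (F : (Fin d → ℝ) → ℝ) (x : Fin d → ℝ) : ℝ :=
  (1 / 2 : ℝ) * ∑ i, ∑ j, ((if i = j then x i else 0) - x i * x j) *
    partialDeriv i (partialDeriv j F) x

/-- `σ²(x) = F(x) (1 - F(x))`. -/
def sigmaSq {d : ℕ} (F : (Fin d → ℝ) → ℝ) (x : Fin d → ℝ) : ℝ := F x * (1 - F x)

/-- `V(x) = ∑_i ∂F/∂x_i (x) √(x_i (1 - x_i) / π)`. -/
def varTerm {d : ℕ} (F : (Fin d → ℝ) → ℝ) (x : Fin d → ℝ) : ℝ :=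
  ∑ i, partialDeriv i F x * Real.sqrt (x i * (1 - x i) / Real.pi)

/-- `∫_𝒮 σ²(x) dx`. -/
def intSigmaSq {d : ℕ} (F : (Fin d → ℝ) → ℝ) : ℝ := ∫ x in simplex d, sigmaSq F x

/-- `∫_𝒮 V(x) dx`. -/
def intV {d : ℕ} (F : (Fin d → ℝ) → ℝ) : ℝ := ∫ x in simplex d, varTerm F x

/-- `∫_𝒮 B²(x) dx`. -/
def intBSq {d : ℕ} (F : (Fin d → ℝ) → ℝ) : ℝ := ∫ x in simplex d, biasTerm F x ^ 2

/-- The expansion `n⁻¹ ∫σ² - n⁻¹ t^{-1/2} ∫V + t⁻² ∫B²` as a function of a real bandwidth `t`. -/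
def leadingMISE {d : ℕ} (F : (Fin d → ℝ) → ℝ) (n : ℕ) (t : ℝ) : ℝ :=
  (n : ℝ)⁻¹ * intSigmaSq F - (n : ℝ)⁻¹ * t ^ (-(1 / 2) : ℝ) * intV F + t ^ (-2 : ℝ) * intBSq F

/-- `m_opt = n^{2/3} [4 ∫B² / ∫V]^{2/3}`, as a real number. -/
def mOpt {d : ℕ} (F : (Fin d → ℝ) → ℝ) (n : ℕ) : ℝ :=
  (n : ℝ) ^ (2 / 3 : ℝ) * (4 * intBSq F / intV F) ^ (2 / 3 : ℝ)

/-- A choice `m = m(n)` of the bandwidth is asymptotically optimal with respect to a risk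
`R(n, m)`, at the scale `ε(n)`, if no choice `m'` of positive integers has a risk smaller than
that of `m` by more than `o(ε(n))`. -/
def AsymptoticallyOptimal (R : ℕ → ℕ → ℝ) (ε : ℕ → ℝ) (m : ℕ → ℕ) : Prop :=
  ∀ m' : ℕ → ℕ, (∀ n, 1 ≤ m' n) →
    ∃ r : ℕ → ℝ, r =o[atTop] ε ∧ ∀ n, R n (m n) ≤ R n (m' n) + r n

end

end BernsteinSimplex

namespace BernsteinSimplex

/-! ### Multinomial means -/

/-! The estimator at `x` is an average of `n` i.i.d. copies of `bernsteinKernel m x`, so the mean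
squared error is variance plus squared bias, and Fubini integrates this over the simplex
(`MISE_eq`): MISE = n⁻¹ ∫ `bernsteinVar` + ∫ (`bernsteinPoly` - F)². Both integrands are means over
multinomial vectors, and their limits come from Taylor expansion and moments.

Bias: in the expansion of F(K/m) about `x`, with K multinomial, the linear term has mean zero and
the quadratic term has mean `biasTerm` / m, while the fourth moments absorb the remainder
(`tendsto_mul_bernsteinPoly_sub`).

Variance: a product of indicators of two lower orthants is the indicator of the orthant below the
infimum, so the second moment of the kernel is the mean of F(K/m ⊓ L/m) for independent multinomials
K, L. Linearising F leaves the mean of min(K_i, L_i)/m - x_i, which is -E|K_i - L_i| / (2m). The law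
of K_i - L_i enters through |s| = (2/π) ∫ (1 - cos(st)) / t² dt and its explicit cosine mean;
dominated convergence gives E|K_i - L_i| / √m → 2 √(x_i(1 - x_i)/π)
(`tendsto_multinomialMean_pair_abs`). Uniform bounds then carry both limits under the integral over
the simplex.

Optimisation: with T the optimal bandwidth and u = √(T/k), the risk minus its σ² term, multiplied by
T², is close to B(u⁴ - 4u), whose only minimum on u ≥ 0 is -3B at u = 1. Uniformity in `k` is the
difficulty: the asymptotics say nothing about bounded `k`. There it is enough that the integrated
squared bias is strictly positive (`integral_bernsteinPoly_sub_sq_pos`), because a function fixed by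
the Bernstein operator is affine by a maximum principle, which would force B = 0. -/

lemma mem_multiIndices {d m : ℕ} {k : Fin d → ℕ} : k ∈ multiIndices d m ↔ ∑ i, k i ≤ m := by
  simp only [multiIndices, Finset.mem_filter, Fintype.mem_piFinset, Finset.mem_range,
    and_iff_right_iff_imp]
  intro h i
  have := Finset.single_le_sum (f := k) (fun _ _ => Nat.zero_le _) (Finset.mem_univ i)
  omega

/-- The mean of `G` under the multinomial law with `m` trials and probabilities `x`. -/
noncomputable def multinomialMean {d : ℕ} (m : ℕ) (x : Fin d → ℝ) (G : (Fin d → ℕ) → ℝ) : ℝ :=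
  ∑ k ∈ multiIndices d m, G k * multinomialWeight m k x

lemma norm1_of_mem {d : ℕ} {x : Fin d → ℝ} (hx : x ∈ simplex d) : norm1 x = ∑ i, x i :=
  Finset.sum_congr rfl fun i _ => abs_of_nonneg (hx.1 i).1

lemma multinomialWeight_nonneg {d m : ℕ} (k : Fin d → ℕ) {x : Fin d → ℝ} (hx : x ∈ simplex d) :
    0 ≤ multinomialWeight m k x := by
  have h1 : 0 ≤ 1 - norm1 x := sub_nonneg.2 hx.2
  have h2 : 0 ≤ ∏ i, x i ^ k i := Finset.prod_nonneg fun i _ => pow_nonneg (hx.1 i).1 _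
  unfold multinomialWeight
  positivity

/-- Stated without division because it is applied to powers of `x i`, which may vanish, as well as
to factorials. -/
lemma prod_update_pred_mul {d : ℕ} {M : Type*} [CommMonoid M] (g : Fin d → ℕ → M)
    (k : Fin d → ℕ) (i : Fin d) :
    (∏ j, g j ((k - Pi.single i 1 : Fin d → ℕ) j)) * g i (k i) = (∏ j, g j (k j)) * g i (k i - 1) := by
  classical
  rw [← Finset.mul_prod_erase _ _ (Finset.mem_univ i),
    ← Finset.mul_prod_erase _ (fun j => g j (k j)) (Finset.mem_univ i)]
  have : ∏ j ∈ Finset.univ.erase i, g j ((k - Pi.single i 1 : Fin d → ℕ) j)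
      = ∏ j ∈ Finset.univ.erase i, g j (k j) := by
    refine Finset.prod_congr rfl fun j hj => ?_
    simp [Finset.ne_of_mem_erase hj]
  rw [this]
  simp [mul_comm, mul_left_comm]

lemma sum_sub_single {d : ℕ} {k : Fin d → ℕ} {i : Fin d} (hi : 1 ≤ k i) :
    ∑ j, (k - Pi.single i 1 : Fin d → ℕ) j + 1 = ∑ j, k j := by
  have hle : Pi.single i 1 ≤ k := by
    intro j
    rcases eq_or_ne j i with rfl | h
    · simpa using hi
    · simp [h]
  conv_rhs => rw [← tsub_add_cancel_of_le hle]
  simp [Finset.sum_add_distrib]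

lemma multinomialWeight_pred {d m : ℕ} {k : Fin d → ℕ} {i : Fin d} (hi : 1 ≤ k i) (x : Fin d → ℝ) :
    x i * multinomialWeight m (k - Pi.single i 1 : Fin d → ℕ) x
      = (k i : ℝ) / (m + 1) * multinomialWeight (m + 1) k x := by
  have hs := sum_sub_single hi
  have hsub : m + 1 - ∑ j, k j = m - ∑ j, (k - Pi.single i 1 : Fin d → ℕ) j := by omega
  have hfac := prod_update_pred_mul (fun _ n => (n.factorial : ℝ)) k i
  have hpow := prod_update_pred_mul (fun j n => x j ^ n) k i
  obtain ⟨c, hc⟩ : ∃ c, k i = c + 1 := ⟨k i - 1, by omega⟩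
  have h1 : (∏ j, ((k - Pi.single i 1 : Fin d → ℕ) j).factorial : ℝ) * (k i) = ∏ j, ((k j).factorial : ℝ) := by
    simp only [hc, Nat.add_sub_cancel, Nat.factorial_succ] at hfac ⊢
    have : (c.factorial : ℝ) ≠ 0 := by positivity
    apply mul_right_cancel₀ this
    push_cast at hfac ⊢
    linarith
  have hpos : (∏ j, ((k - Pi.single i 1 : Fin d → ℕ) j).factorial : ℝ) ≠ 0 := by positivity
  have hki : (k i : ℝ) ≠ 0 := by positivity
  have h2 : x i * ∏ j, x j ^ (k - Pi.single i 1 : Fin d → ℕ) j = ∏ j, x j ^ k j := by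
    rcases eq_or_ne (x i) 0 with h0 | h0
    · rw [h0, zero_mul, eq_comm, Finset.prod_eq_zero (Finset.mem_univ i)]
      simp [h0, hc]
    · have : x i ^ c ≠ 0 := pow_ne_zero _ h0
      apply mul_right_cancel₀ this
      simp only [hc, Nat.add_sub_cancel, pow_succ] at hpow
      linarith
  unfold multinomialWeight
  rw [hsub, ← h1, ← h2, Nat.factorial_succ]
  push_cast
  have : (m : ℝ) + 1 ≠ 0 := by positivity
  field_simp

lemma multinomialWeight_slack {d m : ℕ} {k : Fin d → ℕ} (hk : ∑ i, k i ≤ m) (x : Fin d → ℝ) :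
    (1 - norm1 x) * multinomialWeight m k x
      = ((m + 1 - ∑ i, k i : ℕ) : ℝ) / (m + 1) * multinomialWeight (m + 1) k x := by
  obtain ⟨c, hc⟩ : ∃ c, m - ∑ i, k i = c := ⟨_, rfl⟩
  have hc' : m + 1 - ∑ i, k i = c + 1 := by omega
  unfold multinomialWeight
  rw [hc, hc', Nat.factorial_succ, Nat.factorial_succ]
  push_cast
  have : (m : ℝ) + 1 ≠ 0 := by positivity
  field_simp
  ring

/-- Conditioning on the last trial. The shares `k i / (m + 1)` and `(m + 1 - ∑ k) / (m + 1)` from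
`multinomialWeight_pred` and `multinomialWeight_slack` add up to one. All moments below follow from
this recursion by induction on `m`. -/
lemma multinomialMean_succ {d : ℕ} (m : ℕ) (x : Fin d → ℝ) (G : (Fin d → ℕ) → ℝ) :
    multinomialMean (m + 1) x G = (1 - norm1 x) * multinomialMean m x G
      + ∑ i, x i * multinomialMean m x (fun k => G (k + Pi.single i 1)) := by
  have hm : (m : ℝ) + 1 ≠ 0 := by positivity
  have hslack : (1 - norm1 x) * multinomialMean m x G = ∑ k ∈ multiIndices d (m + 1),
      G k * (((m + 1 - ∑ i, k i : ℕ) : ℝ) / (m + 1) * multinomialWeight (m + 1) k x) := by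
    have hsub : multiIndices d m ⊆ multiIndices d (m + 1) := fun k hk => by
      rw [mem_multiIndices] at hk ⊢; omega
    rw [← Finset.sum_subset hsub, multinomialMean, Finset.mul_sum]
    · refine Finset.sum_congr rfl fun k hk => ?_
      rw [← multinomialWeight_slack (mem_multiIndices.1 hk)]; ring
    -- The additional indices have total `m + 1`, where the slack coefficient is zero.
    · intro k hk hk'
      rw [mem_multiIndices] at hk hk'
      have : m + 1 - ∑ i, k i = 0 := by omega
      simp [this]
  have hstep : ∀ i, x i * multinomialMean m x (fun k => G (k + Pi.single i 1))
      = ∑ k ∈ multiIndices d (m + 1),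
        G k * ((k i : ℝ) / (m + 1) * multinomialWeight (m + 1) k x) := by
    intro i
    have h0 : ∑ k ∈ (multiIndices d (m + 1)).filter (fun k => 1 ≤ k i),
        G k * ((k i : ℝ) / (m + 1) * multinomialWeight (m + 1) k x)
        = ∑ k ∈ multiIndices d (m + 1),
        G k * ((k i : ℝ) / (m + 1) * multinomialWeight (m + 1) k x) := by
      refine Finset.sum_subset (Finset.filter_subset _ _) fun k hk hk' => ?_
      have : k i = 0 := by
        by_contra h
        exact hk' (Finset.mem_filter.2 ⟨hk, by omega⟩)
      simp [this]
    rw [← h0, multinomialMean, Finset.mul_sum]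
    refine Finset.sum_nbij' (fun k => k + Pi.single i 1) (fun k => k - Pi.single i 1) ?_ ?_ ?_ ?_ ?_
    · intro k hk
      rw [mem_multiIndices] at hk
      rw [Finset.mem_filter, mem_multiIndices]
      simp [Finset.sum_add_distrib, hk]
    · intro k hk
      rw [Finset.mem_filter, mem_multiIndices] at hk
      rw [mem_multiIndices]
      have := sum_sub_single hk.2
      omega
    · intro k _
      simp
    · intro k hk
      rw [Finset.mem_filter] at hk
      refine tsub_add_cancel_of_le fun j => ?_
      rcases eq_or_ne j i with rfl | h
      · simpa using hk.2
      · simp [h]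
    · intro k _
      have := multinomialWeight_pred (m := m) (k := k + Pi.single i 1) (i := i) (by simp) x
      rw [add_tsub_cancel_right] at this
      rw [← this]; ring
  rw [hslack, Finset.sum_congr rfl fun i _ => hstep i, Finset.sum_comm, ← Finset.sum_add_distrib,
    multinomialMean]
  refine Finset.sum_congr rfl fun k hk => ?_
  rw [← Finset.mul_sum, ← Finset.sum_mul, ← mul_add, ← add_mul, ← Finset.sum_div, ← add_div,
    Nat.cast_sub (mem_multiIndices.1 hk)]
  push_cast
  rw [sub_add_cancel, div_self hm, one_mul]

lemma multinomialMean_zero {d : ℕ} (x : Fin d → ℝ) (G : (Fin d → ℕ) → ℝ) :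
    multinomialMean 0 x G = G 0 := by
  have : multiIndices d 0 = {0} := by
    ext k
    simp [mem_multiIndices, funext_iff]
  simp [multinomialMean, this, multinomialWeight]

section linear
variable {d : ℕ} (m : ℕ) (x : Fin d → ℝ) (G H : (Fin d → ℕ) → ℝ) (c : ℝ)

lemma multinomialMean_add : multinomialMean m x (fun k => G k + H k)
    = multinomialMean m x G + multinomialMean m x H := by
  simp [multinomialMean, add_mul, Finset.sum_add_distrib]

lemma multinomialMean_sub : multinomialMean m x (fun k => G k - H k)
    = multinomialMean m x G - multinomialMean m x H := by
  simp [multinomialMean, sub_mul, Finset.sum_sub_distrib]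

lemma multinomialMean_const_mul : multinomialMean m x (fun k => c * G k)
    = c * multinomialMean m x G := by
  simp [multinomialMean, Finset.mul_sum, mul_assoc]

lemma multinomialMean_mul_const : multinomialMean m x (fun k => G k * c)
    = multinomialMean m x G * c := by
  simp only [mul_comm _ c, multinomialMean_const_mul]

lemma multinomialMean_div_const : multinomialMean m x (fun k => G k / c)
    = multinomialMean m x G / c := by
  simp only [div_eq_mul_inv, multinomialMean_mul_const]

lemma multinomialMean_sum {ι : Type*} (s : Finset ι) (G : ι → (Fin d → ℕ) → ℝ) :
    multinomialMean m x (fun k => ∑ j ∈ s, G j k) = ∑ j ∈ s, multinomialMean m x (G j) := by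
  simp only [multinomialMean, Finset.sum_mul]
  exact Finset.sum_comm

variable {m x G H}

lemma multinomialMean_mono (hx : x ∈ simplex d) (h : ∀ k ∈ multiIndices d m, G k ≤ H k) :
    multinomialMean m x G ≤ multinomialMean m x H :=
  Finset.sum_le_sum fun k hk => mul_le_mul_of_nonneg_right (h k hk) (multinomialWeight_nonneg k hx)

lemma abs_multinomialMean_le (hx : x ∈ simplex d) :
    |multinomialMean m x G| ≤ multinomialMean m x (fun k => |G k|) := by
  refine (Finset.abs_sum_le_sum_abs _ _).trans (Finset.sum_le_sum fun k _ => ?_)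
  rw [abs_mul, abs_of_nonneg (multinomialWeight_nonneg k hx)]

variable (m)

lemma multinomialMean_const (hx : x ∈ simplex d) : multinomialMean m x (fun _ => c) = c := by
  induction m with
  | zero => rw [multinomialMean_zero]
  | succ m ih => rw [multinomialMean_succ, ih, ← Finset.sum_mul, norm1_of_mem hx]; ring

/-- One more trial, seen through the `i`-th coordinate only. -/
lemma multinomialMean_succ_apply (hx : x ∈ simplex d) (i : Fin d) (h : ℕ → ℝ) :
    multinomialMean (m + 1) x (fun k => h (k i)) =
      (1 - x i) * multinomialMean m x (fun k => h (k i))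
        + x i * multinomialMean m x (fun k => h (k i + 1)) := by
  rw [multinomialMean_succ, ← Finset.add_sum_erase _ _ (Finset.mem_univ i)]
  have : ∑ j ∈ Finset.univ.erase i,
      x j * multinomialMean m x (fun k => h ((k + Pi.single j 1 : Fin d → ℕ) i))
      = (norm1 x - x i) * multinomialMean m x (fun k => h (k i)) := by
    rw [norm1_of_mem hx, ← Finset.add_sum_erase _ _ (Finset.mem_univ i), add_sub_cancel_left,
      Finset.sum_mul]
    refine Finset.sum_congr rfl fun j hj => ?_
    simp [(Finset.ne_of_mem_erase hj).symm]
  rw [this]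
  simp only [Pi.add_apply, Pi.single_eq_same]
  ring

lemma multinomialMean_apply_sub (hx : x ∈ simplex d) (i : Fin d) :
    multinomialMean m x (fun k => (k i : ℝ) - m * x i) = 0 := by
  induction m with
  | zero => simp [multinomialMean_zero]
  | succ m ih =>
    rw [multinomialMean_sub, multinomialMean_const _ _ hx] at ih ⊢
    rw [multinomialMean_succ_apply m hx i (fun n => (n : ℝ))]
    push_cast
    rw [multinomialMean_add, multinomialMean_const _ _ hx]
    linear_combination ih

end linear

/-! ### Central moments of the multinomial law up to order four -/

section moments
variable {d : ℕ} (m : ℕ) {x : Fin d → ℝ}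

lemma multinomialMean_apply_sub_mul_sub (hx : x ∈ simplex d) (i j : Fin d) :
    multinomialMean m x (fun k => ((k i : ℝ) - m * x i) * ((k j : ℝ) - m * x j))
      = m * ((if i = j then x i else 0) - x i * x j) := by
  induction m with
  | zero => simp [multinomialMean_zero]
  | succ m ih =>
    -- One more trial shifts the centred coordinates by constants `a`, `b`; the terms linear in the
    -- deviations vanish by centring.
    have key : ∀ a b : ℝ, multinomialMean m x (fun k => ((k i : ℝ) - m * x i + a) *
        ((k j : ℝ) - m * x j + b)) = m * ((if i = j then x i else 0) - x i * x j) + a * b := by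
      intro a b
      have : (fun k : Fin d → ℕ => ((k i : ℝ) - m * x i + a) * ((k j : ℝ) - m * x j + b)) =
          fun k => ((k i : ℝ) - m * x i) * ((k j : ℝ) - m * x j) + b * ((k i : ℝ) - m * x i)
            + a * ((k j : ℝ) - m * x j) + a * b := by
        ext k; ring
      rw [this]
      simp only [multinomialMean_add, multinomialMean_const_mul, multinomialMean_const _ _ hx,
        multinomialMean_apply_sub _ hx, ih]
      ring
    have h0 : (fun k : Fin d → ℕ => ((k i : ℝ) - (m + 1 : ℕ) * x i) * ((k j : ℝ) - (m + 1 : ℕ) * x j))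
        = fun k => ((k i : ℝ) - m * x i + -x i) * ((k j : ℝ) - m * x j + -x j) := by
      ext k; push_cast; ring
    have h1 : ∀ l, (fun k : Fin d → ℕ =>
        (((k + Pi.single l 1 : Fin d → ℕ) i : ℝ) - (m + 1 : ℕ) * x i) *
          (((k + Pi.single l 1 : Fin d → ℕ) j : ℝ) - (m + 1 : ℕ) * x j))
        = fun k => ((k i : ℝ) - m * x i + ((if l = i then 1 else 0) - x i)) *
          ((k j : ℝ) - m * x j + ((if l = j then 1 else 0) - x j)) := by
      intro l
      ext k
      simp only [Pi.add_apply, Pi.single_apply, eq_comm (a := l)]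
      push_cast
      ring
    rw [multinomialMean_succ]
    simp only [h1]
    rw [h0, key]
    simp only [key]
    have h2 : ∑ l, x l * (m * ((if i = j then x i else 0) - x i * x j)
        + ((if l = i then 1 else 0) - x i) * ((if l = j then 1 else 0) - x j))
        = norm1 x * (m * ((if i = j then x i else 0) - x i * x j) + x i * x j)
          + ((if i = j then x i else 0) - 2 * x i * x j) := by
      have : ∀ l, x l * (m * ((if i = j then x i else 0) - x i * x j)
        + ((if l = i then 1 else 0) - x i) * ((if l = j then 1 else 0) - x j))
        = x l * (m * ((if i = j then x i else 0) - x i * x j) + x i * x j)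
          + ((if l = i then (if i = j then x i else 0) else 0)
            - x i * (if l = j then x l else 0) - (if l = i then x l else 0) * x j) := by
        intro l
        by_cases h : l = i <;> by_cases h' : l = j <;> by_cases h'' : i = j <;> simp_all <;> ring
      simp only [this, Finset.sum_add_distrib, Finset.sum_sub_distrib, ← Finset.mul_sum,
        ← Finset.sum_mul, norm1_of_mem hx]
      simp
      ring
    rw [h2]
    push_cast
    ring

lemma multinomialMean_sq (hx : x ∈ simplex d) (i : Fin d) :
    multinomialMean m x (fun k => ((k i : ℝ) - m * x i) ^ 2) = m * (x i * (1 - x i)) := by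
  have := multinomialMean_apply_sub_mul_sub m hx i i
  simp only [← sq, if_true] at this
  rw [this]; ring

lemma multinomialMean_pow_three (hx : x ∈ simplex d) (i : Fin d) :
    multinomialMean m x (fun k => ((k i : ℝ) - m * x i) ^ 3)
      = m * (x i * (1 - x i) * (1 - 2 * x i)) := by
  induction m with
  | zero => simp [multinomialMean_zero]
  | succ m ih =>
    have key : ∀ a : ℝ, multinomialMean m x (fun k => ((k i : ℝ) - m * x i + a) ^ 3)
        = m * (x i * (1 - x i) * (1 - 2 * x i)) + 3 * a * (m * (x i * (1 - x i))) + a ^ 3 := by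
      intro a
      have : (fun k : Fin d → ℕ => ((k i : ℝ) - m * x i + a) ^ 3) =
          fun k => ((k i : ℝ) - m * x i) ^ 3 + 3 * a * ((k i : ℝ) - m * x i) ^ 2
            + 3 * a ^ 2 * ((k i : ℝ) - m * x i) + a ^ 3 := by
        ext k; ring
      rw [this]
      simp only [multinomialMean_add, multinomialMean_const_mul, multinomialMean_const _ _ hx,
        multinomialMean_apply_sub _ hx, multinomialMean_sq _ hx, ih]
      ring
    rw [multinomialMean_succ_apply m hx i (fun n => ((n : ℝ) - (m + 1 : ℕ) * x i) ^ 3)]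
    have h0 : (fun k : Fin d → ℕ => ((k i : ℝ) - (m + 1 : ℕ) * x i) ^ 3)
        = fun k => ((k i : ℝ) - m * x i + -x i) ^ 3 := by
      ext k; push_cast; ring
    have h1 : (fun k : Fin d → ℕ => (((k i + 1 : ℕ) : ℝ) - (m + 1 : ℕ) * x i) ^ 3)
        = fun k => ((k i : ℝ) - m * x i + (1 - x i)) ^ 3 := by
      ext k; push_cast; ring
    rw [h0, h1, key, key]
    push_cast
    ring

lemma multinomialMean_pow_four (hx : x ∈ simplex d) (i : Fin d) :
    multinomialMean m x (fun k => ((k i : ℝ) - m * x i) ^ 4)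
      = m * (x i * (1 - x i) * (1 - 6 * (x i * (1 - x i)))) + 3 * (m * (x i * (1 - x i))) ^ 2 := by
  induction m with
  | zero => simp [multinomialMean_zero]
  | succ m ih =>
    have key : ∀ a : ℝ, multinomialMean m x (fun k => ((k i : ℝ) - m * x i + a) ^ 4)
        = m * (x i * (1 - x i) * (1 - 6 * (x i * (1 - x i)))) + 3 * (m * (x i * (1 - x i))) ^ 2
          + 4 * a * (m * (x i * (1 - x i) * (1 - 2 * x i)))
          + 6 * a ^ 2 * (m * (x i * (1 - x i))) + a ^ 4 := by
      intro a
      have : (fun k : Fin d → ℕ => ((k i : ℝ) - m * x i + a) ^ 4) =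
          fun k => ((k i : ℝ) - m * x i) ^ 4 + 4 * a * ((k i : ℝ) - m * x i) ^ 3
            + 6 * a ^ 2 * ((k i : ℝ) - m * x i) ^ 2
            + 4 * a ^ 3 * ((k i : ℝ) - m * x i) + a ^ 4 := by
        ext k; ring
      rw [this]
      simp only [multinomialMean_add, multinomialMean_const_mul, multinomialMean_const _ _ hx,
        multinomialMean_apply_sub _ hx, multinomialMean_sq _ hx, multinomialMean_pow_three _ hx, ih]
      ring
    rw [multinomialMean_succ_apply m hx i (fun n => ((n : ℝ) - (m + 1 : ℕ) * x i) ^ 4)]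
    have h0 : (fun k : Fin d → ℕ => ((k i : ℝ) - (m + 1 : ℕ) * x i) ^ 4)
        = fun k => ((k i : ℝ) - m * x i + -x i) ^ 4 := by
      ext k; push_cast; ring
    have h1 : (fun k : Fin d → ℕ => (((k i + 1 : ℕ) : ℝ) - (m + 1 : ℕ) * x i) ^ 4)
        = fun k => ((k i : ℝ) - m * x i + (1 - x i)) ^ 4 := by
      ext k; push_cast; ring
    rw [h0, h1, key, key]
    push_cast
    ring

lemma mul_one_sub_mem (hx : x ∈ simplex d) (i : Fin d) :
    0 ≤ x i * (1 - x i) ∧ x i * (1 - x i) ≤ 1 / 4 := by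
  obtain ⟨h0, h1⟩ := hx.1 i
  exact ⟨mul_nonneg h0 (by linarith), by nlinarith [sq_nonneg (x i - 1 / 2)]⟩

/-- After division by `m ^ 4` this is O(m⁻²), negligible against the bias scale m⁻¹. -/
lemma multinomialMean_pow_four_le (hx : x ∈ simplex d) (i : Fin d) :
    multinomialMean m x (fun k => ((k i : ℝ) - m * x i) ^ 4) ≤ (m : ℝ) ^ 2 := by
  rw [multinomialMean_pow_four m hx]
  obtain ⟨h0, h1⟩ := mul_one_sub_mem hx i
  set p := x i * (1 - x i)
  have hm : (m : ℝ) ≤ m ^ 2 := by exact_mod_cast Nat.le_self_pow (by norm_num) m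
  have hm0 : (0 : ℝ) ≤ m := m.cast_nonneg
  have a1 : m * (p * (1 - 6 * p)) ≤ m * (1 / 4) :=
    mul_le_mul_of_nonneg_left (by nlinarith) hm0
  have a2 : (m * p) ^ 2 ≤ (m * (1 / 4)) ^ 2 := by gcongr
  nlinarith

/-! ### Two independent copies of a multinomial vector -/

/-- With p = x_i(1 - x_i), one more trial in each copy moves the difference by +1 or -1 with
probability p each, and leaves it in place otherwise. -/
lemma multinomialMean_pair_succ (hx : x ∈ simplex d) (i : Fin d) (h : ℝ → ℝ) :
    multinomialMean (m + 1) x (fun k => multinomialMean (m + 1) x (fun l => h ((k i : ℝ) - l i)))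
      = (1 - 2 * (x i * (1 - x i))) *
          multinomialMean m x (fun k => multinomialMean m x (fun l => h ((k i : ℝ) - l i)))
        + x i * (1 - x i) *
          (multinomialMean m x (fun k => multinomialMean m x (fun l => h ((k i : ℝ) - l i + 1)))
          + multinomialMean m x (fun k => multinomialMean m x (fun l => h ((k i : ℝ) - l i - 1)))) := by
  have inner : ∀ a : ℝ, multinomialMean (m + 1) x (fun l => h (a - l i))
      = (1 - x i) * multinomialMean m x (fun l => h (a - l i))
        + x i * multinomialMean m x (fun l => h (a - l i - 1)) := by
    intro a
    rw [multinomialMean_succ_apply m hx i (fun n => h (a - n))]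
    simp only [Nat.cast_add, Nat.cast_one, sub_sub]
  simp only [inner]
  rw [multinomialMean_succ_apply m hx i (fun n => (1 - x i) * multinomialMean m x
    (fun l => h ((n : ℝ) - l i)) + x i * multinomialMean m x (fun l => h ((n : ℝ) - l i - 1)))]
  have e1 : ∀ (k l : Fin d → ℕ), ((k i + 1 : ℕ) : ℝ) - l i = (k i : ℝ) - l i + 1 := by
    intro k l; push_cast; ring
  simp only [e1, add_sub_cancel_right, multinomialMean_add, multinomialMean_const_mul]
  ring

/-- The phase `a` makes the induction close: the two moves turn it into `a + t` and `a - t`, and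
cos(a + t) + cos(a - t) = 2 cos a cos t. -/
lemma multinomialMean_pair_cos (hx : x ∈ simplex d) (i : Fin d) (t a : ℝ) :
    multinomialMean m x (fun k => multinomialMean m x
      (fun l => Real.cos (t * ((k i : ℝ) - l i) + a)))
      = (1 - 2 * (x i * (1 - x i)) + 2 * (x i * (1 - x i)) * Real.cos t) ^ m * Real.cos a := by
  induction m generalizing a with
  | zero => simp [multinomialMean_zero]
  | succ m ih =>
    rw [multinomialMean_pair_succ m hx i (fun s => Real.cos (t * s + a))]
    have e1 : ∀ k l : Fin d → ℕ, t * ((k i : ℝ) - l i + 1) + a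
        = t * ((k i : ℝ) - l i) + (a + t) := by intros; ring
    have e2 : ∀ k l : Fin d → ℕ, t * ((k i : ℝ) - l i - 1) + a
        = t * ((k i : ℝ) - l i) + (a - t) := by intros; ring
    simp only [e1, e2, ih]
    rw [← mul_add, Real.cos_add, Real.cos_sub]
    ring

lemma multinomialMean_pair_sq (hx : x ∈ simplex d) (i : Fin d) :
    multinomialMean m x (fun k => multinomialMean m x (fun l => ((k i : ℝ) - l i) ^ 2))
      = 2 * (m * (x i * (1 - x i))) := by
  have : ∀ k l : Fin d → ℕ, ((k i : ℝ) - l i) ^ 2 = ((k i : ℝ) - m * x i) ^ 2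
      - 2 * ((k i : ℝ) - m * x i) * ((l i : ℝ) - m * x i) + ((l i : ℝ) - m * x i) ^ 2 := by
    intros; ring
  simp only [this, multinomialMean_add, multinomialMean_sub, multinomialMean_const_mul,
    multinomialMean_const _ _ hx, multinomialMean_sq _ hx, multinomialMean_apply_sub _ hx]
  simp [multinomialMean_const _ _ hx]
  ring

lemma multinomialMean_pair_abs_le (hx : x ∈ simplex d) (i : Fin d) :
    multinomialMean m x (fun k => multinomialMean m x (fun l => |(k i : ℝ) - l i|)) ≤ √m := by
  rcases Nat.eq_zero_or_pos m with rfl | hm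
  · simp [multinomialMean_zero]
  have hs : 0 < √(m : ℝ) := Real.sqrt_pos.2 (by exact_mod_cast hm)
  -- Linearised Cauchy–Schwarz: the second moment is at most m/2, so the two terms contribute at
  -- most √m/2 and √m/4.
  have h1 : ∀ a : ℝ, |a| ≤ a ^ 2 / √m + √m / 4 := by
    intro a
    rw [← sq_abs a, div_add' _ _ _ hs.ne', le_div_iff₀ hs]
    nlinarith [sq_nonneg (|a| - √m / 2)]
  refine (multinomialMean_mono hx fun k _ => multinomialMean_mono hx fun l _ => h1 _).trans ?_
  simp only [multinomialMean_add, multinomialMean_div_const, multinomialMean_const _ _ hx,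
    multinomialMean_pair_sq _ hx]
  obtain ⟨h0, h1⟩ := mul_one_sub_mem hx i
  have h2 : 2 * (m * (x i * (1 - x i))) / √m = 2 * (x i * (1 - x i)) * √m := by
    have := Real.mul_self_sqrt (m.cast_nonneg (α := ℝ))
    rw [div_eq_iff hs.ne']
    linear_combination -2 * (x i * (1 - x i)) * this
  rw [h2]
  nlinarith

end moments

/-! ### The integrals of `(1 - cos t) / t²` and `(1 - exp (-p t²)) / t²` -/

/-- One integrable majorant covers both ends of the half-line: N ≤ a t² near zero and N ≤ 2 at
infinity. It also dominates the limit in `tendsto_multinomialMean_pair_abs`. -/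
lemma div_sq_le_inv_one_add_sq {a N t : ℝ} (ht : 0 < t) (h2 : N ≤ 2) (ha : N ≤ a * t ^ 2) :
    N / t ^ 2 ≤ (a + 2) * (1 + t ^ 2)⁻¹ := by
  rw [← div_eq_mul_inv, div_le_div_iff₀ (by positivity) (by positivity)]
  nlinarith [sq_nonneg t]

lemma integrableOn_div_sq {N : ℝ → ℝ} {a : ℝ} (hc : Continuous N)
    (h0 : ∀ t, 0 ≤ N t) (h2 : ∀ t, N t ≤ 2) (ha : ∀ t, N t ≤ a * t ^ 2) :
    IntegrableOn (fun t => N t / t ^ 2) (Set.Ioi 0) := by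
  refine Integrable.mono' (g := fun t => (a + 2) * (1 + t ^ 2)⁻¹)
    (integrable_inv_one_add_sq.const_mul _).integrableOn ?_ ?_
  · exact (hc.measurable.div (measurable_id.pow_const 2)).aestronglyMeasurable
  · filter_upwards [ae_restrict_mem measurableSet_Ioi] with t ht
    rw [Real.norm_of_nonneg (div_nonneg (h0 t) (sq_nonneg t))]
    exact div_sq_le_inv_one_add_sq ht (h2 t) (ha t)

lemma one_sub_cos_le (t : ℝ) : 1 - Real.cos t ≤ 1 / 2 * t ^ 2 := by
  linarith [Real.one_sub_sq_div_two_le_cos (x := t)]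

lemma integrableOn_one_sub_cos_div_sq (s : ℝ) :
    IntegrableOn (fun t => (1 - Real.cos (s * t)) / t ^ 2) (Set.Ioi 0) :=
  integrableOn_div_sq (a := 1 / 2 * s ^ 2) (by fun_prop)
    (fun t => by linarith [Real.cos_le_one (s * t)])
    (fun t => by linarith [Real.neg_one_le_cos (s * t)])
    (fun t => (one_sub_cos_le (s * t)).trans_eq (by ring))

lemma laplace_one_sub_cos {u : ℝ} (hu : 0 < u) :
    IntegrableOn (fun t => (1 - Real.cos t) * Real.exp (-(u * t))) (Set.Ioi 0) ∧
    ∫ t in Set.Ioi 0, (1 - Real.cos t) * Real.exp (-(u * t)) = 1 / (u * (1 + u ^ 2)) := by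
  set G : ℝ → ℝ := fun t => Real.exp (-(u * t)) *
    (-(1 / u) - (Real.sin t - u * Real.cos t) / (1 + u ^ 2)) with hG
  have h1 : (1 + u ^ 2) ≠ 0 := by positivity
  have hd : ∀ t ∈ Set.Ici (0 : ℝ), HasDerivAt G ((1 - Real.cos t) * Real.exp (-(u * t))) t := by
    intro t _
    have e1 : HasDerivAt (fun t => Real.exp (-(u * t))) (Real.exp (-(u * t)) * (-(u * 1))) t :=
      (((hasDerivAt_id t).const_mul u).neg).exp
    have e2 : HasDerivAt (fun t => -(1 / u) - (Real.sin t - u * Real.cos t) / (1 + u ^ 2))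
        (-((Real.cos t - u * (-Real.sin t)) / (1 + u ^ 2))) t :=
      (((Real.hasDerivAt_sin t).sub ((Real.hasDerivAt_cos t).const_mul u)).div_const _).const_sub _
    convert! e1.mul e2 using 1
    field_simp
    ring
  have hpos : ∀ t ∈ Set.Ioi (0 : ℝ), 0 ≤ (1 - Real.cos t) * Real.exp (-(u * t)) := fun t _ =>
    mul_nonneg (by linarith [Real.cos_le_one t]) (Real.exp_pos _).le
  have hlim : Tendsto G atTop (𝓝 0) := by
    have he : Tendsto (fun t : ℝ => Real.exp (-(u * t))) atTop (𝓝 0) :=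
      Real.tendsto_exp_neg_atTop_nhds_zero.comp (tendsto_id.const_mul_atTop hu)
    have hb : ∀ t, |(-(1 / u) - (Real.sin t - u * Real.cos t) / (1 + u ^ 2))|
        ≤ 1 / u + (1 + u) / (1 + u ^ 2) := by
      intro t
      refine (abs_sub _ _).trans (add_le_add ?_ ?_)
      · rw [abs_neg, abs_of_pos (by positivity)]
      · rw [abs_div, abs_of_pos (by positivity : 0 < 1 + u ^ 2)]
        gcongr
        refine (abs_sub _ _).trans (add_le_add (Real.abs_sin_le_one t) ?_)
        rw [abs_mul, abs_of_pos hu]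
        nlinarith [Real.abs_cos_le_one t]
    refine squeeze_zero_norm (a := fun t => Real.exp (-(u * t)) *
      (1 / u + (1 + u) / (1 + u ^ 2))) (fun t => ?_) (by simpa using he.mul_const _)
    rw [hG, norm_mul, Real.norm_of_nonneg (Real.exp_pos _).le]
    exact mul_le_mul_of_nonneg_left (hb t) (Real.exp_pos _).le
  refine ⟨integrableOn_Ioi_deriv_of_nonneg' hd hpos hlim, ?_⟩
  rw [integral_Ioi_of_hasDerivAt_of_nonneg' hd hpos hlim]
  simp only [hG, mul_zero, neg_zero, Real.exp_zero, Real.sin_zero, Real.cos_zero]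
  field_simp
  ring

lemma integral_mul_exp_neg_mul {t : ℝ} (ht : 0 < t) :
    IntegrableOn (fun u => u * Real.exp (-(u * t))) (Set.Ioi 0) ∧
    ∫ u in Set.Ioi 0, u * Real.exp (-(u * t)) = 1 / t ^ 2 := by
  have h := Real.integral_rpow_mul_exp_neg_mul_Ioi (a := 2) (by norm_num) ht
  have h' : ∀ u : ℝ, u ^ ((2 : ℝ) - 1) * Real.exp (-(t * u)) = u * Real.exp (-(u * t)) := by
    intro u
    norm_num
    left; ring_nf
  simp only [h', Real.Gamma_two, mul_one, one_div] at h
  have h2 : ∫ u in Set.Ioi 0, u * Real.exp (-(u * t)) = 1 / t ^ 2 := by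
    rw [h]; norm_num
  refine ⟨?_, h2⟩
  -- A non-integrable function has integral zero by convention, which contradicts the positive value
  -- just computed.
  by_contra hn
  rw [IntegrableOn] at hn
  rw [integral_undef hn] at h2
  have : 0 < 1 / t ^ 2 := by positivity
  linarith

/-- Write 1/t² as ∫ u exp(-ut) du and swap: the inner integral becomes u times the Laplace transform
of 1 - cos, that is 1/(1 + u²). -/
lemma integral_one_sub_cos_div_sq :
    ∫ t in Set.Ioi 0, (1 - Real.cos t) / t ^ 2 = Real.pi / 2 := by
  set f : ℝ → ℝ → ℝ := fun t u => (1 - Real.cos t) * (u * Real.exp (-(u * t))) with hf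
  have hc : ∀ t, 0 ≤ 1 - Real.cos t := fun t => by linarith [Real.cos_le_one t]
  have hin : ∀ t ∈ Set.Ioi (0 : ℝ), ∫ u in Set.Ioi 0, f t u = (1 - Real.cos t) / t ^ 2 := by
    intro t ht
    rw [hf, integral_const_mul, (integral_mul_exp_neg_mul ht).2, mul_one_div]
  have hnorm : ∀ t ∈ Set.Ioi (0 : ℝ), ∫ u in Set.Ioi 0, ‖f t u‖ = (1 - Real.cos t) / t ^ 2 := by
    intro t ht
    rw [← hin t ht]
    refine setIntegral_congr_fun measurableSet_Ioi fun u hu => ?_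
    exact Real.norm_of_nonneg (mul_nonneg (hc t) (mul_nonneg (le_of_lt hu) (Real.exp_pos _).le))
  have hint : Integrable (Function.uncurry f)
      ((volume.restrict (Set.Ioi 0)).prod (volume.restrict (Set.Ioi 0))) := by
    rw [integrable_prod_iff]
    · constructor
      · filter_upwards [ae_restrict_mem measurableSet_Ioi] with t ht
        exact (integral_mul_exp_neg_mul ht).1.const_mul (1 - Real.cos t)
      · have := integrableOn_one_sub_cos_div_sq 1
        simp only [one_mul] at this
        exact this.congr_fun (fun t ht => (hnorm t ht).symm) measurableSet_Ioi
    · refine Continuous.aestronglyMeasurable ?_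
      simp only [hf, Function.uncurry_def]
      fun_prop
  calc ∫ t in Set.Ioi 0, (1 - Real.cos t) / t ^ 2
      = ∫ t in Set.Ioi 0, ∫ u in Set.Ioi 0, f t u :=
        setIntegral_congr_fun measurableSet_Ioi fun t ht => (hin t ht).symm
    _ = ∫ u in Set.Ioi 0, ∫ t in Set.Ioi 0, f t u := integral_integral_swap hint
    _ = ∫ u in Set.Ioi (0 : ℝ), (1 + u ^ 2)⁻¹ := by
        refine setIntegral_congr_fun measurableSet_Ioi fun u hu => ?_
        have hu' : 0 < u := hu
        have e : ∀ t, f t u = u * ((1 - Real.cos t) * Real.exp (-(u * t))) := by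
          intro t; simp only [hf]; ring
        simp only [e]
        rw [integral_const_mul, (laplace_one_sub_cos hu').2]
        field_simp
    _ = Real.pi / 2 := by rw [integral_Ioi_inv_one_add_sq]; simp

/-- Represents the absolute value as a superposition of cosines, whose means are known from
`multinomialMean_pair_cos`. -/
lemma integral_one_sub_cos_mul_div_sq (s : ℝ) :
    ∫ t in Set.Ioi 0, (1 - Real.cos (s * t)) / t ^ 2 = Real.pi / 2 * |s| := by
  rcases eq_or_ne s 0 with rfl | hs
  · simp
  have hs' : 0 < |s| := abs_pos.2 hs
  have e : ∀ t, (1 - Real.cos (s * t)) / t ^ 2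
      = |s| ^ 2 * ((1 - Real.cos (|s| * t)) / (|s| * t) ^ 2) := by
    intro t
    have : Real.cos (|s| * t) = Real.cos (s * t) := by
      rcases abs_choice s with h | h <;> simp [h]
    rw [this, mul_pow, ← mul_div_assoc, mul_div_mul_left _ _ (by positivity)]
  simp only [e]
  rw [integral_const_mul, integral_comp_mul_left_Ioi (fun t => (1 - Real.cos t) / t ^ 2) 0 hs',
    mul_zero, integral_one_sub_cos_div_sq, smul_eq_mul]
  field_simp

lemma one_sub_exp_neg_le (x : ℝ) : 1 - Real.exp (-x) ≤ x := by
  linarith [Real.add_one_le_exp (-x)]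

lemma integrableOn_one_sub_exp_div_sq {p : ℝ} (hp : 0 ≤ p) :
    IntegrableOn (fun t => (1 - Real.exp (-(p * t ^ 2))) / t ^ 2) (Set.Ioi 0) :=
  integrableOn_div_sq (a := p) (by fun_prop)
    (fun t => sub_nonneg.2 (Real.exp_le_one_iff.2 (by nlinarith [mul_nonneg hp (sq_nonneg t)])))
    (fun t => by linarith [Real.exp_pos (-(p * t ^ 2))])
    (fun t => one_sub_exp_neg_le _)

/-- Integration by parts: the boundary term `G` vanishes at zero and at infinity, so the integral
equals that of the Gaussian `h`. -/
lemma integral_one_sub_exp_div_sq {p : ℝ} (hp : 0 ≤ p) :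
    ∫ t in Set.Ioi 0, (1 - Real.exp (-(p * t ^ 2))) / t ^ 2 = √(Real.pi * p) := by
  rcases hp.eq_or_lt with rfl | hp'
  · simp
  set G : ℝ → ℝ := fun t => -((1 - Real.exp (-(p * t ^ 2))) / t) with hG
  set g : ℝ → ℝ := fun t => (1 - Real.exp (-(p * t ^ 2))) / t ^ 2 with hg
  set h : ℝ → ℝ := fun t => 2 * p * Real.exp (-p * t ^ 2) with hh
  have hnn : ∀ t : ℝ, 0 ≤ 1 - Real.exp (-(p * t ^ 2)) := fun t =>
    sub_nonneg.2 (Real.exp_le_one_iff.2 (by nlinarith [mul_nonneg hp (sq_nonneg t)]))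
  have hd : ∀ t ∈ Set.Ioi (0 : ℝ), HasDerivAt G (g t - h t) t := by
    intro t ht
    have ht' : t ≠ 0 := ne_of_gt ht
    have e1 : HasDerivAt (fun t : ℝ => 1 - Real.exp (-(p * t ^ 2)))
        (-(Real.exp (-(p * t ^ 2)) * (-(p * (2 * t))))) t := by
      have := ((((hasDerivAt_pow 2 t).const_mul p).neg).exp).const_sub 1
      simpa using this
    convert! (e1.div (hasDerivAt_id t) ht').neg using 1
    simp only [hg, hh, id, neg_mul]
    field_simp
    ring
  have hgi := integrableOn_one_sub_exp_div_sq hp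
  have hhi : IntegrableOn h (Set.Ioi 0) := ((integrable_exp_neg_mul_sq hp').const_mul _).integrableOn
  have hGle : ∀ t : ℝ, |G t| ≤ p * |t| := by
    intro t
    rcases eq_or_ne t 0 with rfl | h0
    · simp [hG]
    rw [hG, abs_neg, abs_div, abs_of_nonneg (hnn t), div_le_iff₀ (abs_pos.2 h0), mul_assoc,
      ← sq, sq_abs]
    exact one_sub_exp_neg_le _
  -- Division by zero makes `G 0 = 0`, which is also the limit because `|G t| ≤ p * |t|`.
  have hcont : ContinuousWithinAt G (Set.Ici 0) 0 := by
    have : Tendsto G (𝓝 0) (𝓝 0) := by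
      refine squeeze_zero_norm hGle ?_
      have : Continuous fun t : ℝ => p * |t| := by fun_prop
      simpa using this.tendsto 0
    have h0 : G 0 = 0 := by simp [hG]
    exact ContinuousAt.continuousWithinAt (by rwa [ContinuousAt, h0])
  have hlim : Tendsto G atTop (𝓝 0) := by
    refine squeeze_zero_norm' (a := fun t : ℝ => t⁻¹) ?_ tendsto_inv_atTop_zero
    filter_upwards [eventually_gt_atTop 0] with t ht
    rw [hG, norm_neg, norm_div, Real.norm_of_nonneg (hnn t), Real.norm_of_nonneg ht.le,
      div_eq_mul_inv]
    exact mul_le_of_le_one_left (by positivity) (by linarith [Real.exp_pos (-(p * t ^ 2))])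
  have := integral_Ioi_of_hasDerivAt_of_tendsto hcont hd (hgi.sub hhi) hlim
  rw [integral_sub hgi hhi, hh, integral_const_mul, integral_gaussian_Ioi] at this
  have hG0 : G 0 = 0 := by simp [hG]
  rw [hG0, sub_zero, sub_eq_zero] at this
  rw [this, Real.sqrt_div Real.pi_pos.le, Real.sqrt_mul Real.pi_pos.le]
  have hs : √p ≠ 0 := (Real.sqrt_pos.2 hp').ne'
  have := Real.mul_self_sqrt hp
  field_simp
  linear_combination -this

/-! ### Mean absolute difference of two independent binomial variables -/

lemma tendsto_mul_one_sub_cos_div_sqrt (t : ℝ) :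
    Tendsto (fun m : ℕ => (m : ℝ) * (1 - Real.cos (t / √m))) atTop (𝓝 (t ^ 2 / 2)) := by
  have hsq : Tendsto (fun m : ℕ => √(m : ℝ)) atTop atTop :=
    Real.tendsto_sqrt_atTop.comp tendsto_natCast_atTop_atTop
  have h0 : Tendsto (fun m : ℕ => t / √m) atTop (𝓝 0) := tendsto_const_nhds.div_atTop hsq
  rw [tendsto_iff_norm_sub_tendsto_zero]
  -- The constant 5/96 is the one in `Real.cos_bound`, which requires an argument of absolute value
  -- at most one.
  refine squeeze_zero' (g := fun m : ℕ => t ^ 2 * (t / √m) ^ 2 * (5 / 96)) (.of_forall fun _ =>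
    norm_nonneg _) ?_ ?_
  · filter_upwards [h0.eventually (Metric.closedBall_mem_nhds 0 one_pos), eventually_ge_atTop 1]
      with m hm hm1
    rw [Real.dist_0_eq_abs] at hm
    have hm0 : (0 : ℝ) < m := by exact_mod_cast hm1
    have hs : √(m : ℝ) ^ 2 = m := Real.sq_sqrt hm0.le
    have key := Real.cos_bound hm
    have e1 : (m : ℝ) * (1 - Real.cos (t / √m)) - t ^ 2 / 2
        = -(m * (Real.cos (t / √m) - (1 - (t / √m) ^ 2 / 2))) := by
      rw [div_pow, hs]; field_simp; ring
    rw [e1, norm_neg, Real.norm_eq_abs, abs_mul, abs_of_pos hm0]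
    refine (mul_le_mul_of_nonneg_left key hm0.le).trans_eq ?_
    rw [show |t / √m| ^ 4 = (|t / √m| ^ 2) ^ 2 by ring, sq_abs, sq ((t / √m) ^ 2)]
    nth_rewrite 1 [div_pow]
    rw [hs]
    field_simp
  · have := (((h0.pow 2).const_mul (t ^ 2)).mul_const (5 / 96))
    simpa using this

lemma pi_mul_multinomialMean_pair_abs {d : ℕ} (m : ℕ) {x : Fin d → ℝ} (hx : x ∈ simplex d)
    (i : Fin d) :
    Real.pi / 2 * (multinomialMean m x (fun k => multinomialMean m x
      (fun l => |(k i : ℝ) - l i|)) / √m)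
      = ∫ t in Set.Ioi 0, (1 - (1 - 2 * (x i * (1 - x i)) +
          2 * (x i * (1 - x i)) * Real.cos (t / √m)) ^ m) / t ^ 2 := by
  have e0 : ∀ t : ℝ, (1 - (1 - 2 * (x i * (1 - x i)) +
      2 * (x i * (1 - x i)) * Real.cos (t / √m)) ^ m) / t ^ 2
      = ∑ k ∈ multiIndices d m, ∑ l ∈ multiIndices d m,
        (1 - Real.cos (((k i : ℝ) - l i) / √m * t)) / t ^ 2
          * (multinomialWeight m k x * multinomialWeight m l x) := by
    intro t
    have h := multinomialMean_pair_cos m hx i (t / √m) 0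
    rw [Real.cos_zero, mul_one] at h
    have h' : multinomialMean m x (fun k => multinomialMean m x (fun l =>
        (1 - Real.cos (((k i : ℝ) - l i) / √m * t)) / t ^ 2)) = (1 - (1 - 2 * (x i * (1 - x i)) +
      2 * (x i * (1 - x i)) * Real.cos (t / √m)) ^ m) / t ^ 2 := by
      simp only [multinomialMean_div_const, multinomialMean_sub, multinomialMean_const _ _ hx]
      rw [← h]
      congr 3
      ext k; congr 1; ext l; congr 1; ring
    rw [← h']
    simp only [multinomialMean, Finset.sum_mul]
    exact Finset.sum_congr rfl fun _ _ => Finset.sum_congr rfl fun _ _ => by ring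
  simp only [e0]
  have hint : ∀ k l : Fin d → ℕ, Integrable (fun t : ℝ =>
      (1 - Real.cos (((k i : ℝ) - l i) / √m * t)) / t ^ 2
          * (multinomialWeight m k x * multinomialWeight m l x)) (volume.restrict (Set.Ioi 0)) :=
    fun k l => (integrableOn_one_sub_cos_div_sq _).mul_const _
  rw [integral_finsetSum _ fun k _ => integrable_finsetSum _ fun l _ => hint k l]
  have e1 : ∀ k : Fin d → ℕ, ∫ t in Set.Ioi 0, (∑ l ∈ multiIndices d m,
        (1 - Real.cos (((k i : ℝ) - l i) / √m * t)) / t ^ 2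
          * (multinomialWeight m k x * multinomialWeight m l x))
      = ∑ l ∈ multiIndices d m, Real.pi / 2 * (|(k i : ℝ) - l i| / √m)
          * (multinomialWeight m k x * multinomialWeight m l x) := by
    intro k
    rw [integral_finsetSum _ fun l _ => hint k l]
    refine Finset.sum_congr rfl fun l _ => ?_
    rw [integral_mul_const, integral_one_sub_cos_mul_div_sq, abs_div,
      abs_of_nonneg (Real.sqrt_nonneg _)]
  simp only [e1]
  simp only [multinomialMean, Finset.sum_mul, Finset.sum_div, Finset.mul_sum]
  exact Finset.sum_congr rfl fun _ _ => Finset.sum_congr rfl fun _ _ => by ring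

/-- By the cosine representation it suffices to pass to the limit in an integral over `t`, where the
`m`-th power tends to exp(-p t²). -/
lemma tendsto_multinomialMean_pair_abs {d : ℕ} {x : Fin d → ℝ} (hx : x ∈ simplex d) (i : Fin d) :
    Tendsto (fun m : ℕ => multinomialMean m x (fun k => multinomialMean m x
      (fun l => |(k i : ℝ) - l i|)) / √m) atTop
      (𝓝 (2 * √(x i * (1 - x i) / Real.pi))) := by
  obtain ⟨hp0, hp1⟩ := mul_one_sub_mem hx i
  set p := x i * (1 - x i) with hp
  have hpi := Real.pi_pos
  have hlim : Tendsto (fun m : ℕ => ∫ t in Set.Ioi 0, (1 - (1 - 2 * p +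
      2 * p * Real.cos (t / √m)) ^ m) / t ^ 2) atTop (𝓝 √(Real.pi * p)) := by
    rw [← integral_one_sub_exp_div_sq hp0]
    -- The base is at least 1 - 4p, which is nonnegative because p ≤ 1/4.
    have hq : ∀ s : ℝ, 0 ≤ 1 - 2 * p + 2 * p * Real.cos s ∧
        1 - 2 * p + 2 * p * Real.cos s ≤ 1 := fun s =>
      ⟨by nlinarith [Real.neg_one_le_cos s], by nlinarith [Real.cos_le_one s]⟩
    refine tendsto_integral_of_dominated_convergence (fun t => (p + 2) * (1 + t ^ 2)⁻¹) ?_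
      (integrable_inv_one_add_sq.const_mul _).integrableOn ?_ ?_
    · intro m
      refine Measurable.aestronglyMeasurable ?_
      fun_prop
    · intro m
      filter_upwards [ae_restrict_mem measurableSet_Ioi] with t ht
      have h01 : 0 ≤ 1 - (1 - 2 * p + 2 * p * Real.cos (t / √m)) ^ m :=
        sub_nonneg.2 (pow_le_one₀ (hq _).1 (hq _).2)
      rw [Real.norm_of_nonneg (div_nonneg h01 (sq_nonneg t))]
      refine div_sq_le_inv_one_add_sq ht ?_ ?_
      · linarith [pow_nonneg (hq (t / √m)).1 m]
      · rcases Nat.eq_zero_or_pos m with rfl | hm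
        · simpa using mul_nonneg hp0 (sq_nonneg t)
        have hm0 : (0 : ℝ) < m := by exact_mod_cast hm
        -- Bernoulli's inequality together with 1 - cos s ≤ s²/2 bounds the numerator by p t²,
        -- uniformly in `m`.
        have hb := one_add_mul_le_pow (a := -(2 * p * (1 - Real.cos (t / √m))))
          (by nlinarith [(hq (t / √m)).1]) m
        have e : 1 + -(2 * p * (1 - Real.cos (t / √m))) = 1 - 2 * p + 2 * p * Real.cos (t / √m) := by
          ring
        rw [e] at hb
        have hc := one_sub_cos_le (t / √m)
        rw [div_pow, Real.sq_sqrt hm0.le] at hc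
        have : m * (2 * p * (1 - Real.cos (t / √m))) ≤ m * (2 * p * (1 / 2 * (t ^ 2 / m))) := by
          gcongr
        have e2 : m * (2 * p * (1 / 2 * (t ^ 2 / m))) = p * t ^ 2 := by field_simp
        linarith
    · refine .of_forall fun t => ?_
      refine Tendsto.div_const (Tendsto.const_sub 1 ?_) _
      have hg : Tendsto (fun m : ℕ => (m : ℝ) * (-(2 * p * (1 - Real.cos (t / √m))))) atTop
          (𝓝 (-(p * t ^ 2))) := by
        have := (tendsto_mul_one_sub_cos_div_sqrt t).const_mul (-(2 * p))
        convert! this using 2 <;> ring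
      refine (Real.tendsto_one_add_pow_exp_of_tendsto hg).congr fun m => ?_
      congr 1; ring
  have h2 := hlim.const_mul (2 / Real.pi)
  have e : 2 / Real.pi * √(Real.pi * p) = 2 * √(p / Real.pi) := by
    rw [Real.sqrt_mul hpi.le, Real.sqrt_div' _ hpi.le]
    have h3 := Real.mul_self_sqrt hpi.le
    have : √Real.pi ≠ 0 := (Real.sqrt_pos.2 hpi).ne'
    field_simp
    linear_combination √p * h3
  rw [e] at h2
  refine h2.congr fun m => ?_
  rw [← pi_mul_multinomialMean_pair_abs m hx i]
  field_simp

/-! ### The simplex -/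

lemma continuous_norm1 {d : ℕ} : Continuous (norm1 (d := d)) := by
  unfold norm1; fun_prop

lemma isCompact_simplex (d : ℕ) : IsCompact (simplex d) := by
  have h : simplex d = (Set.univ.pi fun _ => Set.Icc (0 : ℝ) 1) ∩ {x | norm1 x ≤ 1} := by
    ext x; simp only [simplex, Set.mem_ofPred_eq, Set.mem_inter_iff, Set.mem_univ_pi]
  rw [h]
  exact (isCompact_univ_pi fun _ => isCompact_Icc).inter_right
    (isClosed_le continuous_norm1 continuous_const)

lemma measurableSet_simplex (d : ℕ) : MeasurableSet (simplex d) :=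
  (isCompact_simplex d).isClosed.measurableSet

instance isFiniteMeasure_restrict_simplex (d : ℕ) :
    IsFiniteMeasure ((volume : Measure (Fin d → ℝ)).restrict (simplex d)) :=
  ⟨by simpa using (isCompact_simplex d).measure_lt_top⟩

lemma continuous_multinomialWeight {d : ℕ} (m : ℕ) (k : Fin d → ℕ) :
    Continuous (multinomialWeight m k) := by
  have := continuous_norm1 (d := d)
  unfold multinomialWeight
  fun_prop

lemma continuous_multinomialMean {d m : ℕ} {G : (Fin d → ℝ) → (Fin d → ℕ) → ℝ}
    (hG : ∀ k, Continuous fun x => G x k) : Continuous fun x => multinomialMean m x (G x) :=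
  continuous_finsetSum _ fun k _ => (hG k).mul (continuous_multinomialWeight m k)

lemma continuous_bernsteinPoly {d : ℕ} (G : (Fin d → ℝ) → ℝ) (m : ℕ) :
    Continuous (bernsteinPoly G m) :=
  continuous_finsetSum _ fun k _ => continuous_const.mul (continuous_multinomialWeight m k)

lemma bernsteinPoly_eq_multinomialMean {d : ℕ} (G : (Fin d → ℝ) → ℝ) (m : ℕ) (x : Fin d → ℝ) :
    bernsteinPoly G m x = multinomialMean m x (fun k => G fun i => (k i : ℝ) / m) := rfl

/-! ### Bias-variance decomposition -/

/-- `n` times the variance of the Bernstein estimator built on `n` observations. -/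
noncomputable def bernsteinVar {d : ℕ} (F : (Fin d → ℝ) → ℝ) (m : ℕ) (x : Fin d → ℝ) : ℝ :=
  multinomialMean m x (fun k => multinomialMean m x
    (fun l => F ((fun i => (k i : ℝ) / m) ⊓ fun i => (l i : ℝ) / m))) - bernsteinPoly F m x ^ 2

lemma continuous_bernsteinVar {d : ℕ} (F : (Fin d → ℝ) → ℝ) (m : ℕ) :
    Continuous (bernsteinVar F m) := by
  refine Continuous.sub (continuous_multinomialMean (G := fun x k => multinomialMean m x
    (fun l => F ((fun i => (k i : ℝ) / m) ⊓ fun i => (l i : ℝ) / m))) fun k => ?_)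
    ((continuous_bernsteinPoly F m).pow 2)
  exact continuous_multinomialMean
    (G := fun _ l => F ((fun i => (k i : ℝ) / m) ⊓ fun i => (l i : ℝ) / m))
    fun _ => continuous_const

/-- The Bernstein polynomial of the c.d.f. of the Dirac mass at `z`. -/
noncomputable def bernsteinKernel {d : ℕ} (m : ℕ) (x z : Fin d → ℝ) : ℝ :=
  bernsteinPoly (fun y => (Set.Iic y).indicator (fun _ => (1 : ℝ)) z) m x

/-- The Bernstein operator is linear, and the empirical c.d.f. is an average of c.d.f.s of Dirac
masses. -/
lemma bernsteinEstimator_eq {d : ℕ} (z : ℕ → Fin d → ℝ) (n m : ℕ) (x : Fin d → ℝ) :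
    bernsteinEstimator z n m x = (n : ℝ)⁻¹ * ∑ i ∈ Finset.range n, bernsteinKernel m x (z i) := by
  simp only [bernsteinEstimator, bernsteinKernel, bernsteinPoly_eq_multinomialMean, empiricalCDF,
    multinomialMean_const_mul, multinomialMean_sum]

lemma measurable_bernsteinKernel {d : ℕ} (m : ℕ) (x : Fin d → ℝ) :
    Measurable (bernsteinKernel m x) :=
  Finset.measurable_sum _ fun _ _ => (measurable_const.indicator measurableSet_Iic).mul_const _

/-! ### The kernel under the law of the observations, and the MISE -/

section law
variable {d : ℕ} (μ : Measure (Fin d → ℝ))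

lemma integral_indicator_Iic (y : Fin d → ℝ) :
    ∫ z, (Set.Iic y).indicator (fun _ => (1 : ℝ)) z ∂μ = jointCDF μ y := by
  rw [integral_indicator_const _ measurableSet_Iic]; simp [jointCDF]

lemma integral_multinomialMean {m : ℕ} (x : Fin d → ℝ) {G : (Fin d → ℕ) → (Fin d → ℝ) → ℝ}
    (hG : ∀ k, Integrable (G k) μ) : ∫ z, multinomialMean m x (fun k => G k z) ∂μ
      = multinomialMean m x (fun k => ∫ z, G k z ∂μ) := by
  unfold multinomialMean
  rw [integral_finsetSum _ fun k _ => (hG k).mul_const _]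
  simp only [integral_mul_const]

variable [IsProbabilityMeasure μ]

lemma memLp_bernsteinKernel (m : ℕ) (x : Fin d → ℝ) : MemLp (bernsteinKernel m x) 2 μ :=
  memLp_finsetSum _ fun _ _ =>
    (memLp_indicator_const 2 measurableSet_Iic 1 (.inr (measure_ne_top μ _))).mul_const _

lemma integrable_indicator_Iic (y : Fin d → ℝ) :
    Integrable ((Set.Iic y).indicator (fun _ => (1 : ℝ))) μ :=
  (integrable_const 1).indicator measurableSet_Iic

lemma integral_bernsteinKernel (m : ℕ) (x : Fin d → ℝ) :
    ∫ z, bernsteinKernel m x z ∂μ = bernsteinPoly (jointCDF μ) m x := by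
  simp only [bernsteinKernel, bernsteinPoly_eq_multinomialMean]
  rw [integral_multinomialMean μ x fun k => integrable_indicator_Iic μ _]
  simp only [integral_indicator_Iic]

/-- The square of the kernel is a double mean of products of orthant indicators, and `Iic y ∩ Iic y'
= Iic (y ⊓ y')`. -/
lemma variance_bernsteinKernel (m : ℕ) (x : Fin d → ℝ) :
    Var[bernsteinKernel m x; μ] = bernsteinVar (jointCDF μ) m x := by
  rw [variance_eq_sub (memLp_bernsteinKernel μ m x), integral_bernsteinKernel, bernsteinVar]
  congr 1
  have h : ∀ z, (bernsteinKernel m x ^ 2) z = multinomialMean m x (fun k => multinomialMean m x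
      (fun l => (Set.Iic ((fun i => (k i : ℝ) / m) ⊓ fun i => (l i : ℝ) / m)).indicator
        (fun _ => (1 : ℝ)) z)) := by
    intro z
    simp only [Pi.pow_apply, bernsteinKernel, bernsteinPoly_eq_multinomialMean, sq,
      ← Set.Iic_inter_Iic]
    rw [← multinomialMean_mul_const]
    congr 1
    ext k
    rw [← multinomialMean_const_mul]
    congr 1
    ext l
    by_cases h1 : z ∈ Set.Iic (fun i => (k i : ℝ) / m) <;>
      by_cases h2 : z ∈ Set.Iic (fun i => (l i : ℝ) / m) <;> simp [Set.indicator, h1, h2] <;>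
        simp_all
  simp only [h]
  rw [integral_multinomialMean]
  · congr 1
    ext k
    rw [integral_multinomialMean μ x fun l => integrable_indicator_Iic μ _]
    simp only [integral_indicator_Iic]
  · intro k
    exact integrable_finsetSum _ fun l _ => (integrable_indicator_Iic μ _).mul_const _

variable {μ} {Ω : Type*} [MeasurableSpace Ω] {P : Measure Ω} [IsProbabilityMeasure P]
  {X : ℕ → Ω → Fin d → ℝ}

lemma integral_bernsteinEstimator_sub_sq (hlaw : ∀ i, HasLaw (X i) μ P) (hindep : iIndepFun X P)
    {n : ℕ} (hn : 1 ≤ n) (m : ℕ) (x : Fin d → ℝ) (c : ℝ) :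
    ∫ ω, (bernsteinEstimator (fun i => X i ω) n m x - c) ^ 2 ∂P
      = (n : ℝ)⁻¹ * bernsteinVar (jointCDF μ) m x + (bernsteinPoly (jointCDF μ) m x - c) ^ 2 := by
  have hn0 : (n : ℝ) ≠ 0 := by positivity
  set Y : ℕ → Ω → ℝ := fun i ω => bernsteinKernel m x (X i ω) with hY
  have hmap : ∀ i, μ = P.map (X i) := fun i => (hlaw i).map_eq.symm
  have hYL : ∀ i, MemLp (Y i) 2 P := fun i => by
    have := memLp_bernsteinKernel μ m x
    rw [hmap i, memLp_map_measure_iff (measurable_bernsteinKernel m x).aestronglyMeasurable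
      (hlaw i).aemeasurable] at this
    exact this
  have hYE : ∀ i, ∫ ω, Y i ω ∂P = bernsteinPoly (jointCDF μ) m x := fun i => by
    rw [← integral_bernsteinKernel μ m x]
    exact (hlaw i).integral_comp (measurable_bernsteinKernel m x).aestronglyMeasurable
  have hYV : ∀ i, Var[Y i; P] = bernsteinVar (jointCDF μ) m x := fun i => by
    rw [← variance_bernsteinKernel μ m x, hmap i, variance_map
      (measurable_bernsteinKernel m x).aemeasurable (hlaw i).aemeasurable]
    rfl
  set Z : Ω → ℝ := fun ω => (n : ℝ)⁻¹ * (∑ i ∈ Finset.range n, Y i) ω with hZ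
  have hZeq : ∀ ω, bernsteinEstimator (fun i => X i ω) n m x = Z ω := fun ω => by
    rw [bernsteinEstimator_eq, hZ]; simp [hY]
  have hSL : MemLp (∑ i ∈ Finset.range n, Y i) 2 P := memLp_finsetSum' _ fun i _ => hYL i
  have hZL : MemLp Z 2 P := hSL.const_mul _
  have hZE : ∫ ω, Z ω ∂P = bernsteinPoly (jointCDF μ) m x := by
    simp only [hZ, Finset.sum_apply]
    rw [integral_const_mul, integral_finsetSum _ fun i _ => (hYL i).integrable (by norm_num)]
    simp [hYE, hn0]
  have hZV : Var[Z; P] = (n : ℝ)⁻¹ * bernsteinVar (jointCDF μ) m x := by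
    rw [hZ, variance_const_mul, IndepFun.variance_sum (fun i _ => hYL i)]
    · simp [hYV]; field_simp
    · intro i _ j _ hij
      exact (hindep.indepFun hij).comp (measurable_bernsteinKernel m x)
        (measurable_bernsteinKernel m x)
  have hv := variance_sub_const hZL.aestronglyMeasurable c (μ := P)
  have hL2 : MemLp (fun ω => Z ω - c) 2 P := hZL.sub (memLp_const c)
  rw [variance_eq_sub hL2, integral_sub (hZL.integrable (by norm_num)) (integrable_const c),
    hZE, hZV] at hv
  simp only [Pi.pow_apply, integral_const, probReal_univ, one_smul] at hv
  simp only [hZeq]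
  linarith

lemma jointCDF_mem (x : Fin d → ℝ) : 0 ≤ jointCDF μ x ∧ jointCDF μ x ≤ 1 :=
  ⟨measureReal_nonneg, measureReal_le_one⟩

lemma empiricalCDF_mem (z : ℕ → Fin d → ℝ) (n : ℕ) (x : Fin d → ℝ) :
    0 ≤ empiricalCDF z n x ∧ empiricalCDF z n x ≤ 1 := by
  have h : ∀ i, 0 ≤ (Set.Iic x).indicator (fun _ => (1 : ℝ)) (z i) ∧
      (Set.Iic x).indicator (fun _ => (1 : ℝ)) (z i) ≤ 1 := fun i =>
    ⟨Set.indicator_nonneg (fun _ _ => zero_le_one) _,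
      Set.indicator_le_self' (fun _ _ => zero_le_one) _⟩
  constructor
  · exact mul_nonneg (by positivity) (Finset.sum_nonneg fun i _ => (h i).1)
  · refine (mul_le_mul_of_nonneg_left (Finset.sum_le_sum fun i _ => (h i).2)
      (by positivity)).trans ?_
    simpa using inv_mul_le_one

lemma bernsteinPoly_mem {G : (Fin d → ℝ) → ℝ} (hG : ∀ y, 0 ≤ G y ∧ G y ≤ 1) (m : ℕ)
    {x : Fin d → ℝ} (hx : x ∈ simplex d) :
    0 ≤ bernsteinPoly G m x ∧ bernsteinPoly G m x ≤ 1 := by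
  rw [bernsteinPoly_eq_multinomialMean]
  refine ⟨?_, ?_⟩
  · exact (multinomialMean_const m 0 hx).symm.le.trans
      (multinomialMean_mono hx fun k _ => (hG _).1)
  · exact (multinomialMean_mono hx fun k _ => (hG _).2).trans (multinomialMean_const m 1 hx).le

/-- Fubini applies because the estimator and F both lie in [0, 1] on the simplex, so the integrand
is bounded by one. -/
lemma MISE_eq (hF : ContinuousOn (jointCDF μ) (simplex d)) (hlaw : ∀ i, HasLaw (X i) μ P)
    (hindep : iIndepFun X P) {n : ℕ} (hn : 1 ≤ n) (m : ℕ) :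
    MISE P X (jointCDF μ) n m = (n : ℝ)⁻¹ * (∫ x in simplex d, bernsteinVar (jointCDF μ) m x)
      + ∫ x in simplex d, (bernsteinPoly (jointCDF μ) m x - jointCDF μ x) ^ 2 := by
  have hFm : AEStronglyMeasurable (jointCDF μ) (volume.restrict (simplex d)) :=
    hF.aestronglyMeasurable (measurableSet_simplex d)
  have hint : Integrable (Function.uncurry fun (ω : Ω) (x : Fin d → ℝ) =>
      (bernsteinEstimator (fun i => X i ω) n m x - jointCDF μ x) ^ 2)
      (P.prod (volume.restrict (simplex d))) := by
    refine Integrable.of_bound ?_ 1 ?_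
    · refine AEStronglyMeasurable.pow (AEStronglyMeasurable.sub ?_ hFm.comp_snd) 2
      -- Joint measurability: the estimator is a finite sum of products of a function of `ω` and a
      -- function of `x`.
      refine Finset.aestronglyMeasurable_fun_sum _ fun k _ => AEStronglyMeasurable.mul ?_
        (continuous_multinomialWeight m k).aestronglyMeasurable.comp_snd
      have h1 : ∀ i ∈ Finset.range n, AEMeasurable (fun ω =>
          (Set.Iic fun i => (k i : ℝ) / (m : ℝ)).indicator (fun _ => (1 : ℝ)) (X i ω)) P :=
        fun i _ => (measurable_const.indicator measurableSet_Iic).comp_aemeasurable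
          (hlaw i).aemeasurable
      have h2 := ((Finset.aemeasurable_fun_sum _ h1).const_mul (n : ℝ)⁻¹).aestronglyMeasurable
      exact h2.comp_fst
    · have hae : ∀ᵐ p : Ω × (Fin d → ℝ) ∂(P.prod (volume.restrict (simplex d))),
          p.2 ∈ simplex d :=
        Measure.quasiMeasurePreserving_snd.ae (ae_restrict_mem (measurableSet_simplex d))
      filter_upwards [hae] with p hp
      have h1 := bernsteinPoly_mem (empiricalCDF_mem (fun i => X i p.1) n) m hp
      have h2 := jointCDF_mem (μ := μ) p.2
      rw [Function.uncurry_def, norm_pow, Real.norm_eq_abs, sq_abs, sq_le_one_iff_abs_le_one,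
        abs_le, bernsteinEstimator]
      constructor <;> linarith
  rw [MISE, integral_integral_swap hint]
  simp only [integral_bernsteinEstimator_sub_sq hlaw hindep hn]
  rw [integral_add, integral_const_mul]
  · exact (continuous_bernsteinVar _ m).continuousOn.integrableOn_compact
      (isCompact_simplex d) |>.const_mul _
  · exact ContinuousOn.integrableOn_compact (isCompact_simplex d)
      (((continuous_bernsteinPoly _ m).continuousOn.sub hF).pow 2)

end law

/-! ### Taylor estimates on a compact convex set -/

section taylor
variable {E : Type*} [NormedAddCommGroup E] [NormedSpace ℝ E] {s : Set E} {f : E → ℝ}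

/-- The second derivative is bounded on the compact set, so the first is Lipschitz. The mean value
inequality is applied on the part of `s` within `‖y - x‖` of `x`, which is still convex. -/
lemma exists_norm_sub_sub_fderivWithin_le (hs : Convex ℝ s) (hc : IsCompact s)
    (hne : (interior s).Nonempty) (hf : ContDiffOn ℝ 2 f s) :
    ∃ L, 0 ≤ L ∧ ∀ x ∈ s, ∀ y ∈ s,
      |f y - f x - fderivWithin ℝ f s x (y - x)| ≤ L * ‖y - x‖ ^ 2 := by
  have hu := uniqueDiffOn_convex hs hne
  have h1 : ContDiffOn ℝ 1 (fderivWithin ℝ f s) s := hf.fderivWithin hu (by norm_num)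
  have h2 : ContinuousOn (fderivWithin ℝ (fderivWithin ℝ f s) s) s :=
    h1.continuousOn_fderivWithin hu le_rfl
  obtain ⟨L, hL⟩ := hc.exists_bound_of_continuousOn (E := E →L[ℝ] E →L[ℝ] ℝ) h2
  refine ⟨max L 0, le_max_right _ _, fun x hx y hy => ?_⟩
  have hlip : ∀ z ∈ s, ‖fderivWithin ℝ f s z - fderivWithin ℝ f s x‖ ≤ max L 0 * ‖z - x‖ :=
    fun z hz => hs.norm_image_sub_le_of_norm_fderivWithin_le (h1.differentiableOn one_ne_zero)
      (fun w hw => (hL w hw).trans (le_max_left _ _)) hx hz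
  have := Convex.norm_image_sub_le_of_norm_hasFDerivWithin_le' (f := f)
    (s := s ∩ Metric.closedBall x ‖y - x‖) (x := x) (y := y) (C := max L 0 * ‖y - x‖)
    (f' := fderivWithin ℝ f s) (φ := fderivWithin ℝ f s x)
    (fun z hz => ((hf.differentiableOn two_ne_zero) z hz.1).hasFDerivWithinAt.mono
      Set.inter_subset_left)
    (fun z hz => (hlip z hz.1).trans (mul_le_mul_of_nonneg_left
      (by simpa [dist_eq_norm] using hz.2) (le_max_right _ _)))
    (hs.inter (convex_closedBall _ _)) ⟨hx, by simp⟩ ⟨hy, by simp [dist_eq_norm]⟩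
  rw [Real.norm_eq_abs] at this
  exact this.trans_eq (by ring)

lemma exists_abs_taylor_two_le (hs : Convex ℝ s) (hne : (interior s).Nonempty)
    (hf : ContDiffOn ℝ 2 f s) {x : E} (hx : x ∈ s) {ε : ℝ} (hε : 0 < ε) :
    ∃ δ > 0, ∀ y ∈ s, ‖y - x‖ < δ → |f y - f x - fderivWithin ℝ f s x (y - x)
      - 1 / 2 * fderivWithin ℝ (fderivWithin ℝ f s) s x (y - x) (y - x)| ≤ ε * ‖y - x‖ ^ 2 := by
  have hu := uniqueDiffOn_convex hs hne
  have h1 : ContDiffOn ℝ 1 (fderivWithin ℝ f s) s := hf.fderivWithin hu (by norm_num)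
  set D := fderivWithin ℝ f s with hD
  set D2 := fderivWithin ℝ D s x with hD2
  -- Symmetry extends to boundary points because a convex set with interior lies in the closure of
  -- that interior; it is needed to differentiate the quadratic form in `g`.
  have hsymm : ∀ v w, D2 v w = D2 w v := by
    have : IsSymmSndFDerivWithinAt ℝ f s x :=
      (hf x hx).isSymmSndFDerivWithinAt (by simp) hu
        (by rw [hs.closure_interior_eq_closure_of_nonempty_interior hne]; exact subset_closure hx) hx
    exact fun v w => this v w
  have hdiff : HasFDerivWithinAt D D2 s x := (h1.differentiableOn one_ne_zero x hx).hasFDerivWithinAt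
  have hlo := hdiff.isLittleO.def hε
  rw [eventually_nhdsWithin_iff, Metric.eventually_nhds_iff] at hlo
  obtain ⟨δ, hδ, hδ'⟩ := hlo
  refine ⟨δ, hδ, fun y hy hyx => ?_⟩
  set g : E → ℝ := fun z => f z - 1 / 2 * D2 (z - x) (z - x) with hg
  have hgd : ∀ z ∈ s ∩ Metric.closedBall x ‖y - x‖,
      HasFDerivWithinAt g (D z - D2 (z - x)) (s ∩ Metric.closedBall x ‖y - x‖) z := by
    intro z hz
    have e1 : HasFDerivWithinAt f (D z) (s ∩ Metric.closedBall x ‖y - x‖) z :=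
      ((hf.differentiableOn two_ne_zero) z hz.1).hasFDerivWithinAt.mono Set.inter_subset_left
    have e2 : HasFDerivAt (fun z => z - x) (ContinuousLinearMap.id ℝ E) z :=
      (hasFDerivAt_id z).sub_const x
    have e3 := (D2.hasFDerivAt_of_bilinear e2 e2).const_mul (1 / 2 : ℝ)
    refine (e1.sub e3.hasFDerivWithinAt).congr_fderiv ?_
    ext v
    simp [ContinuousLinearMap.precompR_apply, ContinuousLinearMap.precompL_apply, hsymm v]
    ring
  have := Convex.norm_image_sub_le_of_norm_hasFDerivWithin_le' (φ := D x)
    (C := ε * ‖y - x‖) hgd (fun z hz => ?_) (hs.inter (convex_closedBall _ _))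
    (⟨hx, by simp⟩ : x ∈ s ∩ Metric.closedBall x ‖y - x‖) ⟨hy, by simp [dist_eq_norm]⟩
  · rw [Real.norm_eq_abs] at this
    have e : g y - g x - D x (y - x) = f y - f x - D x (y - x) - 1 / 2 * D2 (y - x) (y - x) := by
      simp only [hg, sub_self, map_zero]; ring
    rw [e] at this
    exact this.trans_eq (by ring)
  · have hz2 : ‖z - x‖ ≤ ‖y - x‖ := by simpa [dist_eq_norm] using hz.2
    have := hδ' (y := z) (by rw [dist_eq_norm]; exact hz2.trans_lt hyx) hz.1
    rw [show D z - D2 (z - x) - D x = D z - D x - D2 (z - x) by abel]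
    exact this.trans (mul_le_mul_of_nonneg_left hz2 hε.le)

/-- Beyond distance δ, ‖y - x‖² ≤ ‖y - x‖⁴ / δ². The local remainder thus becomes a global bound by
second and fourth powers, and no tail estimate for the multinomial law is required. -/
lemma exists_abs_taylor_two_le_add_pow_four (hs : Convex ℝ s) (hc : IsCompact s)
    (hne : (interior s).Nonempty) (hf : ContDiffOn ℝ 2 f s) {x : E} (hx : x ∈ s) {ε : ℝ}
    (hε : 0 < ε) :
    ∃ K, ∀ y ∈ s, |f y - f x - fderivWithin ℝ f s x (y - x)
      - 1 / 2 * fderivWithin ℝ (fderivWithin ℝ f s) s x (y - x) (y - x)|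
        ≤ ε * ‖y - x‖ ^ 2 + K * ‖y - x‖ ^ 4 := by
  obtain ⟨δ, hδ, h1⟩ := exists_abs_taylor_two_le hs hne hf hx hε
  obtain ⟨L, hL, h2⟩ := exists_norm_sub_sub_fderivWithin_le hs hc hne hf
  set D2 := fderivWithin ℝ (fderivWithin ℝ f s) s x
  have hK : 0 ≤ (L + ‖D2‖) / δ ^ 2 := by positivity
  refine ⟨(L + ‖D2‖) / δ ^ 2, fun y hy => ?_⟩
  rcases lt_or_ge ‖y - x‖ δ with h | h
  · exact (h1 y hy h).trans (le_add_of_nonneg_right (by positivity))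
  · have e1 : |1 / 2 * D2 (y - x) (y - x)| ≤ ‖D2‖ * ‖y - x‖ ^ 2 := by
      rw [abs_mul, abs_of_pos (by norm_num : (0 : ℝ) < 1 / 2)]
      have : |D2 (y - x) (y - x)| ≤ ‖D2‖ * ‖y - x‖ * ‖y - x‖ := D2.le_opNorm₂ _ _
      nlinarith [abs_nonneg (D2 (y - x) (y - x))]
    have e2 : |f y - f x - fderivWithin ℝ f s x (y - x) - 1 / 2 * D2 (y - x) (y - x)|
        ≤ (L + ‖D2‖) * ‖y - x‖ ^ 2 :=
      (abs_sub _ _).trans (by linarith [h2 x hx y hy])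
    have e3 : (L + ‖D2‖) * ‖y - x‖ ^ 2 ≤ (L + ‖D2‖) / δ ^ 2 * ‖y - x‖ ^ 4 := by
      have : δ ^ 2 ≤ ‖y - x‖ ^ 2 := by gcongr
      rw [div_mul_eq_mul_div, le_div_iff₀ (by positivity), mul_assoc]
      refine mul_le_mul_of_nonneg_left ?_ (by positivity)
      nlinarith [sq_nonneg ‖y - x‖]
    exact (e2.trans e3).trans (le_add_of_nonneg_left (by positivity))

end taylor

/-! ### Geometry of the simplex -/

section geometry
variable {d : ℕ}

lemma convex_simplex (d : ℕ) : Convex ℝ (simplex d) := by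
  have h : simplex d = (⋂ i, {x : Fin d → ℝ | x i ∈ Set.Icc (0 : ℝ) 1}) ∩
      {x : Fin d → ℝ | ∑ i, x i ≤ 1} := by
    ext x
    simp only [simplex, Set.mem_ofPred_eq, Set.mem_inter_iff, Set.mem_iInter]
    refine and_congr_right fun hx => ?_
    rw [norm1, Finset.sum_congr rfl fun i _ => abs_of_nonneg (hx i).1]
  rw [h]
  refine (convex_iInter fun i => ?_).inter ?_
  · exact (convex_Icc (0 : ℝ) 1).linear_preimage (LinearMap.proj (R := ℝ) (φ := fun _ => ℝ) i)
  · have : {x : Fin d → ℝ | ∑ i, x i ≤ 1}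
        = (∑ i, LinearMap.proj (R := ℝ) (φ := fun _ => ℝ) i : (Fin d → ℝ) →ₗ[ℝ] ℝ) ⁻¹'
          Set.Iic 1 := by
      ext x; simp
    rw [this]
    exact (convex_Iic (1 : ℝ)).linear_preimage _

lemma mem_Ioo_of_mem_interior {x : Fin d → ℝ} (hx : x ∈ interior (simplex d)) (i : Fin d) :
    x i ∈ Set.Ioo (0 : ℝ) 1 := by
  have h : simplex d ⊆ Set.univ.pi fun _ => Set.Icc (0 : ℝ) 1 := fun x hx i _ => hx.1 i
  have := interior_mono h hx
  rw [interior_pi_set Set.finite_univ] at this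
  simpa using this i (Set.mem_univ i)

lemma simplex_interior_nonempty (d : ℕ) : (interior (simplex d)).Nonempty := by
  have hopen : IsOpen {x : Fin d → ℝ | (∀ i, 0 < x i) ∧ ∑ i, x i < 1} := by
    have : {x : Fin d → ℝ | (∀ i, 0 < x i) ∧ ∑ i, x i < 1}
        = (⋂ i, {x : Fin d → ℝ | 0 < x i}) ∩ {x | ∑ i, x i < 1} := by
      ext x; simp [Set.mem_iInter]
    rw [this]
    refine IsOpen.inter (isOpen_iInter_of_finite fun i => ?_) ?_
    · exact isOpen_lt continuous_const (continuous_apply i)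
    · exact isOpen_lt (by fun_prop) continuous_const
  have hsub : {x : Fin d → ℝ | (∀ i, 0 < x i) ∧ ∑ i, x i < 1} ⊆ simplex d := by
    intro x hx
    have hn : norm1 x ≤ 1 := by
      rw [norm1, Finset.sum_congr rfl fun i _ => abs_of_nonneg (hx.1 i).le]; exact hx.2.le
    exact ⟨fun i => ⟨(hx.1 i).le, (Finset.single_le_sum (f := x) (fun j _ => (hx.1 j).le)
      (Finset.mem_univ i)).trans hx.2.le⟩, hn⟩
  refine ⟨fun _ => 1 / (d + 1), interior_maximal hsub hopen ⟨fun i => by positivity, ?_⟩⟩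
  simp only [Finset.sum_const, Finset.card_univ, Fintype.card_fin, nsmul_eq_mul]
  rw [mul_one_div, div_lt_one (by positivity)]
  linarith

lemma uniqueDiffOn_simplex (d : ℕ) : UniqueDiffOn ℝ (simplex d) :=
  uniqueDiffOn_convex (convex_simplex d) (simplex_interior_nonempty d)

lemma interior_simplex_ae_eq (d : ℕ) : interior (simplex d) =ᵐ[volume] simplex d :=
  interior_ae_eq_of_null_frontier ((convex_simplex d).addHaar_frontier volume)

lemma simplex_subset_closure_interior (d : ℕ) : simplex d ⊆ closure (interior (simplex d)) := by
  rw [(convex_simplex d).closure_interior_eq_closure_of_nonempty_interior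
    (simplex_interior_nonempty d)]
  exact subset_closure

/-- The norm here is the sup norm; this passes from Taylor remainders to coordinate moments. -/
lemma norm_pow_le_sum (v : Fin d → ℝ) {n : ℕ} (hn : n ≠ 0) : ‖v‖ ^ n ≤ ∑ i, |v i| ^ n := by
  rcases isEmpty_or_nonempty (Fin d) with h | h
  · simp [Subsingleton.elim v 0, hn]
  · obtain ⟨i, hi, h⟩ := Finset.exists_mem_eq_sup Finset.univ Finset.univ_nonempty
      (fun b => ‖v b‖₊)
    rw [Pi.norm_def, h, coe_nnnorm, Real.norm_eq_abs]
    exact Finset.single_le_sum (f := fun i => |v i| ^ n) (fun j _ => by positivity) hi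

lemma div_mem_simplex {m : ℕ} {k : Fin d → ℕ} (hk : ∑ i, k i ≤ m) :
    (fun i => (k i : ℝ) / m) ∈ simplex d := by
  have h0 : ∀ i, 0 ≤ (k i : ℝ) / m := fun i => by positivity
  have hsum : ∑ i, (k i : ℝ) / m ≤ 1 := by
    rw [← Finset.sum_div]
    refine div_le_one_of_le₀ ?_ (Nat.cast_nonneg m)
    exact_mod_cast hk
  refine ⟨fun i => ⟨h0 i, (Finset.single_le_sum (f := fun i => (k i : ℝ) / m) (fun j _ => h0 j)
    (Finset.mem_univ i)).trans hsum⟩, ?_⟩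
  rw [norm1, Finset.sum_congr rfl fun i _ => abs_of_nonneg (h0 i)]
  exact hsum

lemma clm_apply_eq_sum (φ : (Fin d → ℝ) →L[ℝ] ℝ) (v : Fin d → ℝ) :
    φ v = ∑ i, φ (Pi.single i 1) * v i := by
  conv_lhs => rw [pi_eq_sum_univ' v, map_sum]
  refine Finset.sum_congr rfl fun i _ => ?_
  rw [map_smul, smul_eq_mul, mul_comm]

lemma partialDeriv_partialDeriv {F : (Fin d → ℝ) → ℝ} (hF : ContDiffOn ℝ 2 F (simplex d))
    {x : Fin d → ℝ} (hx : x ∈ simplex d) (i j : Fin d) :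
    partialDeriv i (partialDeriv j F) x = fderivWithin ℝ (fderivWithin ℝ F (simplex d))
      (simplex d) x (Pi.single i 1) (Pi.single j 1) := by
  have hu := uniqueDiffOn_simplex d
  have h1 : ContDiffOn ℝ 1 (fderivWithin ℝ F (simplex d)) (simplex d) :=
    hF.fderivWithin hu (by norm_num)
  have h2 := (h1.differentiableOn one_ne_zero x hx).hasFDerivWithinAt
  have h3 : HasFDerivWithinAt (partialDeriv j F) _ (simplex d) x :=
    h2.clm_apply (hasFDerivWithinAt_const (Pi.single j (1 : ℝ) : Fin d → ℝ) x (simplex d))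
  rw [partialDeriv, h3.fderivWithin (hu x hx)]
  simp

end geometry

/-! ### Pointwise asymptotics of bias and variance -/

section moments
variable {d m : ℕ} (hm : 1 ≤ m) {x : Fin d → ℝ} (hx : x ∈ simplex d)
include hm

lemma div_sub_eq (a b : ℝ) : a / m - b = (a - m * b) / m := by
  have : (m : ℝ) ≠ 0 := by positivity
  field_simp

include hx

lemma multinomialMean_div_sub (i : Fin d) :
    multinomialMean m x (fun k => (k i : ℝ) / m - x i) = 0 := by
  simp only [div_sub_eq hm, multinomialMean_div_const, multinomialMean_apply_sub m hx, zero_div]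

lemma multinomialMean_div_sub_mul (i j : Fin d) :
    multinomialMean m x (fun k => ((k i : ℝ) / m - x i) * ((k j : ℝ) / m - x j))
      = ((if i = j then x i else 0) - x i * x j) / m := by
  have : (m : ℝ) ≠ 0 := by positivity
  simp only [div_sub_eq hm, div_mul_div_comm, multinomialMean_div_const,
    multinomialMean_apply_sub_mul_sub m hx]
  field_simp

lemma multinomialMean_sum_sq_le :
    multinomialMean m x (fun k => ∑ i, |(k i : ℝ) / m - x i| ^ 2) ≤ d / 4 / m := by
  have hm0 : (0 : ℝ) < m := by exact_mod_cast hm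
  rw [multinomialMean_sum]
  have : ∀ i, multinomialMean m x (fun k => |(k i : ℝ) / m - x i| ^ 2) ≤ 1 / 4 / m := by
    intro i
    have h := multinomialMean_div_sub_mul hm hx i i
    simp only [if_true, ← sq] at h
    simp only [sq_abs]
    rw [h]
    gcongr
    linarith [(mul_one_sub_mem hx i).2, sq (x i)]
  refine (Finset.sum_le_sum fun i _ => this i).trans_eq ?_
  simp; ring

lemma multinomialMean_sum_pow_four_le :
    multinomialMean m x (fun k => ∑ i, |(k i : ℝ) / m - x i| ^ 4) ≤ d / (m : ℝ) ^ 2 := by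
  have hm0 : (0 : ℝ) < m := by exact_mod_cast hm
  rw [multinomialMean_sum]
  have : ∀ i, multinomialMean m x (fun k => |(k i : ℝ) / m - x i| ^ 4) ≤ 1 / (m : ℝ) ^ 2 := by
    intro i
    have e : ∀ k : Fin d → ℕ, |(k i : ℝ) / m - x i| ^ 4 = ((k i : ℝ) - m * x i) ^ 4 / m ^ 4 := by
      intro k
      rw [Even.pow_abs (by decide), div_sub_eq hm, div_pow]
    simp only [e, multinomialMean_div_const]
    rw [div_le_div_iff₀ (by positivity) (by positivity)]
    nlinarith [multinomialMean_pow_four_le m hx i, pow_pos hm0 2]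
  refine (Finset.sum_le_sum fun i _ => this i).trans_eq ?_
  simp; ring

lemma multinomialMean_clm (φ : (Fin d → ℝ) →L[ℝ] ℝ) :
    multinomialMean m x (fun k => φ ((fun i => (k i : ℝ) / m) - x)) = 0 := by
  simp only [clm_apply_eq_sum φ (_ - _), multinomialMean_sum, multinomialMean_const_mul,
    Pi.sub_apply, multinomialMean_div_sub hm hx, mul_zero, Finset.sum_const_zero]

/-- From min(a, b) = (a + b - |a - b|)/2, where the first two terms are centred. -/
lemma multinomialMean_inf_div (i : Fin d) :
    multinomialMean m x (fun k => multinomialMean m x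
      (fun l => (k i : ℝ) / m ⊓ (l i : ℝ) / m - x i))
      = -(1 / 2) * multinomialMean m x (fun k => multinomialMean m x
        (fun l => |(k i : ℝ) - l i|)) / m := by
  have hm0 : (0 : ℝ) < m := by exact_mod_cast hm
  have e : ∀ k l : Fin d → ℕ, (k i : ℝ) / m ⊓ (l i : ℝ) / m - x i
      = 1 / 2 * ((k i : ℝ) / m - x i) + 1 / 2 * ((l i : ℝ) / m - x i)
        + -(1 / 2) / m * |(k i : ℝ) - l i| := by
    intro k l
    rw [inf_eq_half_smul_add_sub_abs_sub ℝ, ← sub_div, abs_div, abs_of_pos hm0, smul_eq_mul,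
      abs_sub_comm, invOf_eq_inv]
    ring
  simp only [e, multinomialMean_add, multinomialMean_const_mul, multinomialMean_const _ _ hx,
    multinomialMean_div_sub hm hx]
  ring

end moments

section asymptotics
variable {d : ℕ} {F : (Fin d → ℝ) → ℝ}

/-- The linear Taylor term has mean zero, so only second moments remain, each at most 1/(4m). -/
lemma exists_abs_bernsteinPoly_sub_le (hF : ContDiffOn ℝ 2 F (simplex d)) :
    ∃ C, 0 ≤ C ∧ ∀ m : ℕ, 1 ≤ m → ∀ x ∈ simplex d, |bernsteinPoly F m x - F x| ≤ C / m := by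
  obtain ⟨L, hL, h⟩ := exists_norm_sub_sub_fderivWithin_le (convex_simplex d) (isCompact_simplex d)
    (simplex_interior_nonempty d) hF
  refine ⟨L * (d / 4), by positivity, fun m hm x hx => ?_⟩
  have e : bernsteinPoly F m x - F x = multinomialMean m x (fun k =>
      F (fun i => (k i : ℝ) / m) - F x
        - fderivWithin ℝ F (simplex d) x ((fun i => (k i : ℝ) / m) - x)) := by
    rw [multinomialMean_sub, multinomialMean_sub, multinomialMean_clm hm hx,
      multinomialMean_const _ _ hx, sub_zero]
    rfl
  rw [e, mul_div_assoc]
  calc _ ≤ _ := abs_multinomialMean_le hx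
    _ ≤ multinomialMean m x (fun k => L * ∑ i, |(k i : ℝ) / m - x i| ^ 2) := by
        refine multinomialMean_mono hx fun k hk =>
          (h x hx _ (div_mem_simplex (mem_multiIndices.1 hk))).trans ?_
        exact mul_le_mul_of_nonneg_left (norm_pow_le_sum _ two_ne_zero) hL
    _ ≤ L * (d / 4 / m) := by
        rw [multinomialMean_const_mul]
        exact mul_le_mul_of_nonneg_left (multinomialMean_sum_sq_le hm hx) hL

lemma tendsto_mul_bernsteinPoly_sub (hF : ContDiffOn ℝ 2 F (simplex d)) {x : Fin d → ℝ}
    (hx : x ∈ simplex d) :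
    Tendsto (fun m : ℕ => (m : ℝ) * (bernsteinPoly F m x - F x)) atTop (𝓝 (biasTerm F x)) := by
  set D := fderivWithin ℝ F (simplex d) x with hD
  set D2 := fderivWithin ℝ (fderivWithin ℝ F (simplex d)) (simplex d) x with hD2
  have hquad : ∀ v : Fin d → ℝ, D2 v v
      = ∑ i, ∑ j, (v i * v j) * D2 (Pi.single i 1) (Pi.single j 1) := by
    intro v
    have h1 : D2 v v = ∑ j, D2 v (Pi.single j 1) * v j := clm_apply_eq_sum _ _
    have h2 : ∀ j, D2 v (Pi.single j 1) = ∑ i, D2 (Pi.single i 1) (Pi.single j 1) * v i :=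
      fun j => clm_apply_eq_sum (D2.flip (Pi.single j 1)) v
    rw [h1, Finset.sum_comm]
    refine Finset.sum_congr rfl fun j _ => ?_
    rw [h2, Finset.sum_mul]
    exact Finset.sum_congr rfl fun i _ => by ring
  -- An exact identity: the linear Taylor term averages to zero and the quadratic one to `biasTerm F
  -- x / m`.
  have hmain : ∀ m : ℕ, 1 ≤ m → (m : ℝ) * (bernsteinPoly F m x - F x) - biasTerm F x
      = m * multinomialMean m x (fun k => F (fun i => (k i : ℝ) / m) - F x
        - D ((fun i => (k i : ℝ) / m) - x) - 1 / 2 * D2 ((fun i => (k i : ℝ) / m) - x)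
          ((fun i => (k i : ℝ) / m) - x)) := by
    intro m hm
    have hm0 : (m : ℝ) ≠ 0 := by positivity
    have hb : multinomialMean m x (fun k => 1 / 2 * D2 ((fun i => (k i : ℝ) / m) - x)
          ((fun i => (k i : ℝ) / m) - x)) = biasTerm F x / m := by
      simp only [hquad, multinomialMean_const_mul, multinomialMean_sum, multinomialMean_mul_const,
        Pi.sub_apply, multinomialMean_div_sub_mul hm hx, biasTerm, partialDeriv_partialDeriv hF hx,
        ← hD2]
      rw [mul_div_assoc]
      congr 1
      rw [Finset.sum_div]
      refine Finset.sum_congr rfl fun i _ => ?_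
      rw [Finset.sum_div]
      exact Finset.sum_congr rfl fun j _ => by ring
    rw [multinomialMean_sub, hb, multinomialMean_sub, multinomialMean_sub,
      multinomialMean_clm hm hx, multinomialMean_const _ _ hx, bernsteinPoly_eq_multinomialMean]
    field_simp
    ring
  rw [Metric.tendsto_atTop]
  intro ε hε
  -- Division by d + 1 keeps the second-moment contribution, d/4 times this tolerance, strictly
  -- below ε.
  obtain ⟨K, hK⟩ := exists_abs_taylor_two_le_add_pow_four (convex_simplex d) (isCompact_simplex d)
    (simplex_interior_nonempty d) hF hx (ε := ε / (d + 1)) (by positivity)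
  have hlim : Tendsto (fun m : ℕ => ε / (d + 1) * (d / 4) + |K| * d / (m : ℝ)) atTop
      (𝓝 (ε / (d + 1) * (d / 4))) := by
    have := (tendsto_const_div_atTop_nhds_zero_nat (|K| * (d : ℝ))).const_add
      (ε / (d + 1) * (d / 4))
    simpa using this
  have hlt : ε / (d + 1) * (d / 4) < ε := by
    rw [div_mul_eq_mul_div, div_lt_iff₀ (by positivity)]
    have : (0 : ℝ) ≤ d := Nat.cast_nonneg d
    nlinarith
  obtain ⟨N, hN⟩ := eventually_atTop.1 (hlim.eventually_lt_const hlt)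
  refine ⟨max N 1, fun m hm => ?_⟩
  have hm1 : 1 ≤ m := (le_max_right _ _).trans hm
  have hm0 : (0 : ℝ) < m := by exact_mod_cast hm1
  rw [Real.dist_eq, hmain m hm1, abs_mul, abs_of_pos hm0]
  refine lt_of_le_of_lt ?_ (hN m ((le_max_left _ _).trans hm))
  have hle : |multinomialMean m x (fun k => F (fun i => (k i : ℝ) / m) - F x
        - D ((fun i => (k i : ℝ) / m) - x) - 1 / 2 * D2 ((fun i => (k i : ℝ) / m) - x)
          ((fun i => (k i : ℝ) / m) - x))|
      ≤ ε / (d + 1) * (d / 4 / m) + |K| * (d / (m : ℝ) ^ 2) := by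
    calc _ ≤ _ := abs_multinomialMean_le hx
      _ ≤ multinomialMean m x (fun k => ε / (d + 1) * ∑ i, |(k i : ℝ) / m - x i| ^ 2
          + |K| * ∑ i, |(k i : ℝ) / m - x i| ^ 4) := by
          refine multinomialMean_mono hx fun k hk =>
            (hK _ (div_mem_simplex (mem_multiIndices.1 hk))).trans (add_le_add ?_ ?_)
          · exact mul_le_mul_of_nonneg_left (norm_pow_le_sum _ two_ne_zero) (by positivity)
          · exact (mul_le_mul_of_nonneg_right (le_abs_self K) (by positivity)).trans
              (mul_le_mul_of_nonneg_left (norm_pow_le_sum _ four_ne_zero) (abs_nonneg K))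
      _ ≤ _ := by
          rw [multinomialMean_add, multinomialMean_const_mul, multinomialMean_const_mul]
          exact add_le_add
            (mul_le_mul_of_nonneg_left (multinomialMean_sum_sq_le hm1 hx) (by positivity))
            (mul_le_mul_of_nonneg_left (multinomialMean_sum_pow_four_le hm1 hx) (abs_nonneg K))
  refine (mul_le_mul_of_nonneg_left hle hm0.le).trans_eq ?_
  field_simp

/-- `√m` times the mean absolute difference of the `i`-th proportions of two independent
multinomial vectors with `m` trials. -/
noncomputable def scaledAbsDiff {d : ℕ} (m : ℕ) (x : Fin d → ℝ) (i : Fin d) : ℝ :=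
  multinomialMean m x (fun k => multinomialMean m x (fun l => |(k i : ℝ) - l i|)) / √m

lemma scaledAbsDiff_mem {m : ℕ} {x : Fin d → ℝ} (hx : x ∈ simplex d) (i : Fin d) :
    0 ≤ scaledAbsDiff m x i ∧ scaledAbsDiff m x i ≤ 1 := by
  refine ⟨div_nonneg ?_ (Real.sqrt_nonneg _),
    div_le_one_of_le₀ (multinomialMean_pair_abs_le m hx i) (Real.sqrt_nonneg _)⟩
  refine (multinomialMean_const m 0 hx).symm.le.trans (multinomialMean_mono hx fun k _ => ?_)
  exact (multinomialMean_const m 0 hx).symm.le.trans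
    (multinomialMean_mono hx fun l _ => abs_nonneg _)

/-- The variance expansion, up to an error `O(1/√m)` uniform on the simplex. -/
lemma exists_abs_sqrt_mul_bernsteinVar_sub_add_le (hF : ContDiffOn ℝ 2 F (simplex d))
    (h01 : ∀ y, 0 ≤ F y ∧ F y ≤ 1) :
    ∃ C, 0 ≤ C ∧ ∀ m : ℕ, 1 ≤ m → ∀ x ∈ simplex d,
      |√m * (bernsteinVar F m x - sigmaSq F x)
        + ∑ i, partialDeriv i F x * (1 / 2 * scaledAbsDiff m x i)| ≤ C / √m := by
  obtain ⟨L, hL, hT⟩ := exists_norm_sub_sub_fderivWithin_le (convex_simplex d)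
    (isCompact_simplex d) (simplex_interior_nonempty d) hF
  obtain ⟨C, hC, hB⟩ := exists_abs_bernsteinPoly_sub_le hF
  refine ⟨L * (d / 2) + C * 2, by positivity, fun m hm x hx => ?_⟩
  have hm0 : (0 : ℝ) < m := by exact_mod_cast hm
  have hs : 0 < √(m : ℝ) := Real.sqrt_pos.2 hm0
  have hss : √(m : ℝ) * √m = m := Real.mul_self_sqrt hm0.le
  set D := fderivWithin ℝ F (simplex d) x with hD
  set y : (Fin d → ℕ) → (Fin d → ℕ) → Fin d → ℝ :=
    fun k l => (fun i => (k i : ℝ) / m) ⊓ fun i => (l i : ℝ) / m with hy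
  set R := multinomialMean m x (fun k => multinomialMean m x
    (fun l => F (y k l) - F x - D (y k l - x))) with hR
  -- The infimum of two grid points is again a grid point of the simplex, the set on which F is
  -- known to be smooth.
  have hyS : ∀ k ∈ multiIndices d m, ∀ l ∈ multiIndices d m, y k l ∈ simplex d := by
    intro k hk l hl
    have : y k l = fun i => ((k ⊓ l) i : ℝ) / m := by
      ext i
      simp only [hy, Pi.inf_apply]
      rcases le_total (k i) (l i) with h | h
      · rw [inf_of_le_left h, inf_of_le_left]; gcongr
      · rw [inf_of_le_right h, inf_of_le_right]; gcongr
    rw [this]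
    exact div_mem_simplex ((Finset.sum_le_sum fun i _ => inf_le_left).trans
      (mem_multiIndices.1 hk))
  have hRle : |R| ≤ L * (d / 2 / m) := by
    have h1 : ∀ k ∈ multiIndices d m, ∀ l ∈ multiIndices d m,
        |F (y k l) - F x - D (y k l - x)| ≤ L * (∑ i, |(k i : ℝ) / m - x i| ^ 2
          + ∑ i, |(l i : ℝ) / m - x i| ^ 2) := by
      intro k hk l hl
      refine (hT x hx _ (hyS k hk l hl)).trans (mul_le_mul_of_nonneg_left ?_ hL)
      refine (norm_pow_le_sum _ two_ne_zero).trans ?_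
      rw [← Finset.sum_add_distrib]
      refine Finset.sum_le_sum fun i _ => ?_
      simp only [hy, Pi.sub_apply, Pi.inf_apply]
      rcases le_total ((k i : ℝ) / m) ((l i : ℝ) / m) with h | h
      · rw [inf_of_le_left h]; exact le_add_of_nonneg_right (by positivity)
      · rw [inf_of_le_right h]; exact le_add_of_nonneg_left (by positivity)
    calc |R| ≤ multinomialMean m x (fun k => multinomialMean m x
          (fun l => |F (y k l) - F x - D (y k l - x)|)) :=
          (abs_multinomialMean_le hx).trans
            (multinomialMean_mono hx fun k _ => abs_multinomialMean_le hx)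
      _ ≤ multinomialMean m x (fun k => multinomialMean m x (fun l =>
          L * (∑ i, |(k i : ℝ) / m - x i| ^ 2 + ∑ i, |(l i : ℝ) / m - x i| ^ 2))) :=
          multinomialMean_mono hx fun k hk => multinomialMean_mono hx fun l hl => h1 k hk l hl
      _ = L * (multinomialMean m x (fun k => ∑ i, |(k i : ℝ) / m - x i| ^ 2)
          + multinomialMean m x (fun k => ∑ i, |(k i : ℝ) / m - x i| ^ 2)) := by
          simp only [multinomialMean_const_mul, multinomialMean_add, multinomialMean_const _ _ hx]
      _ ≤ L * (d / 4 / m + d / 4 / m) := by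
          have := multinomialMean_sum_sq_le hm hx
          gcongr
      _ = L * (d / 2 / m) := by ring
  have hpair : multinomialMean m x (fun k => multinomialMean m x (fun l => F (y k l)))
      = F x + R - (∑ i, partialDeriv i F x * (1 / 2 * scaledAbsDiff m x i)) / √m := by
    have e1 : ∀ k l, F (y k l) = F x + (F (y k l) - F x - D (y k l - x))
        + ∑ i, D (Pi.single i 1) * ((k i : ℝ) / m ⊓ (l i : ℝ) / m - x i) := by
      intro k l
      have : ∑ i, D (Pi.single i 1) * ((k i : ℝ) / m ⊓ (l i : ℝ) / m - x i) = D (y k l - x) :=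
        (clm_apply_eq_sum D (y k l - x)).symm
      rw [this]; ring
    have e2 : multinomialMean m x (fun k => multinomialMean m x (fun l => F (y k l)))
        = multinomialMean m x (fun k => multinomialMean m x (fun l =>
          F x + (F (y k l) - F x - D (y k l - x))
        + ∑ i, D (Pi.single i 1) * ((k i : ℝ) / m ⊓ (l i : ℝ) / m - x i))) := by
      congr 1; ext k; congr 1; ext l; exact e1 k l
    rw [e2]
    simp only [multinomialMean_add, multinomialMean_sum, multinomialMean_const_mul,
      multinomialMean_const _ _ hx, multinomialMean_inf_div hm hx]
    rw [hR, sub_eq_add_neg, Finset.sum_div, ← Finset.sum_neg_distrib]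
    congr 1
    refine Finset.sum_congr rfl fun i _ => ?_
    rw [scaledAbsDiff, partialDeriv, ← hD]
    generalize multinomialMean m x (fun k => multinomialMean m x
      (fun l => |(k i : ℝ) - l i|)) = A
    have : A / √m / √m = A / m := by rw [div_div, hss]
    linear_combination D (Pi.single i 1) * (1 / 2) * this
  -- With σ² = F - F², replacing the squared Bernstein polynomial by F² costs (`bernsteinPoly` -
  -- F)(`bernsteinPoly` + F), of order 1/m.
  have hfin : √m * (bernsteinVar F m x - sigmaSq F x)
        + ∑ i, partialDeriv i F x * (1 / 2 * scaledAbsDiff m x i)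
      = √m * R - √m * ((bernsteinPoly F m x - F x) * (bernsteinPoly F m x + F x)) := by
    rw [bernsteinVar, hpair, sigmaSq]
    field_simp
    ring
  rw [hfin]
  have hb := hB m hm x hx
  have hb1 := bernsteinPoly_mem h01 m hx
  have hprod : |(bernsteinPoly F m x - F x) * (bernsteinPoly F m x + F x)| ≤ C / m * 2 := by
    rw [abs_mul]
    refine mul_le_mul hb ?_ (abs_nonneg _) (by positivity)
    rw [abs_of_nonneg (add_nonneg hb1.1 (h01 x).1)]
    linarith [hb1.2, (h01 x).2]
  calc |√m * R - √m * ((bernsteinPoly F m x - F x) * (bernsteinPoly F m x + F x))|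
      ≤ √m * (L * (d / 2 / m)) + √m * (C / m * 2) := by
        refine (abs_sub _ _).trans (add_le_add ?_ ?_) <;>
          rw [abs_mul, abs_of_pos hs] <;> gcongr
    _ = (L * (d / 2) + C * 2) / √m := by
        rw [eq_div_iff hs.ne']
        have : √(m : ℝ) * (L * (d / 2 / m)) + √m * (C / m * 2)
          = √m * (L * (d / 2) + C * 2) / m := by ring
        rw [this, div_mul_eq_mul_div, div_eq_iff hm0.ne']
        linear_combination (L * (d / 2) + C * 2) * hss

lemma continuousOn_partialDeriv (hF : ContDiffOn ℝ 2 F (simplex d)) (i : Fin d) :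
    ContinuousOn (partialDeriv i F) (simplex d) :=
  (hF.continuousOn_fderivWithin (uniqueDiffOn_simplex d) one_le_two).clm_apply continuousOn_const

lemma continuousOn_varTerm (hF : ContDiffOn ℝ 2 F (simplex d)) :
    ContinuousOn (varTerm F) (simplex d) :=
  continuousOn_finsetSum _ fun i _ => (continuousOn_partialDeriv hF i).mul
    (Continuous.continuousOn (by fun_prop))

lemma continuousOn_sigmaSq (hF : ContDiffOn ℝ 2 F (simplex d)) :
    ContinuousOn (sigmaSq F) (simplex d) :=
  hF.continuousOn.mul (continuousOn_const.sub hF.continuousOn)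

lemma tendsto_inv_sqrt_natCast : Tendsto (fun m : ℕ => (√(m : ℝ))⁻¹) atTop (𝓝 0) :=
  tendsto_inv_atTop_zero.comp (Real.tendsto_sqrt_atTop.comp tendsto_natCast_atTop_atTop)

lemma tendsto_sqrt_mul_bernsteinVar_sub (hF : ContDiffOn ℝ 2 F (simplex d))
    (h01 : ∀ y, 0 ≤ F y ∧ F y ≤ 1) {x : Fin d → ℝ} (hx : x ∈ simplex d) :
    Tendsto (fun m : ℕ => √m * (bernsteinVar F m x - sigmaSq F x)) atTop (𝓝 (-varTerm F x)) := by
  obtain ⟨C, hC, h⟩ := exists_abs_sqrt_mul_bernsteinVar_sub_add_le hF h01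
  have h1 : Tendsto (fun m : ℕ => √m * (bernsteinVar F m x - sigmaSq F x)
        + ∑ i, partialDeriv i F x * (1 / 2 * scaledAbsDiff m x i)) atTop (𝓝 0) := by
    refine squeeze_zero_norm' (a := fun m : ℕ => C * (√(m : ℝ))⁻¹) ?_
      (by simpa using tendsto_inv_sqrt_natCast.const_mul C)
    filter_upwards [eventually_ge_atTop 1] with m hm
    exact h m hm x hx
  have h2 : Tendsto (fun m : ℕ => ∑ i, partialDeriv i F x * (1 / 2 * scaledAbsDiff m x i)) atTop
      (𝓝 (varTerm F x)) := by
    refine tendsto_finsetSum _ fun i _ => ?_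
    have := (tendsto_multinomialMean_pair_abs hx i).const_mul (1 / 2)
    rw [← mul_assoc, one_div, inv_mul_cancel₀ two_ne_zero, one_mul] at this
    simpa only [one_div, scaledAbsDiff] using this.const_mul (partialDeriv i F x)
  simpa using h1.sub h2

/-- The constant majorant for dominated convergence over the simplex, from `scaledAbsDiff ≤ 1` and
bounded partial derivatives. -/
lemma exists_abs_sqrt_mul_bernsteinVar_sub_le (hF : ContDiffOn ℝ 2 F (simplex d))
    (h01 : ∀ y, 0 ≤ F y ∧ F y ≤ 1) :
    ∃ C, ∀ m : ℕ, 1 ≤ m → ∀ x ∈ simplex d, |√m * (bernsteinVar F m x - sigmaSq F x)| ≤ C := by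
  obtain ⟨C, hC, h⟩ := exists_abs_sqrt_mul_bernsteinVar_sub_add_le hF h01
  choose M hM using fun i => (isCompact_simplex d).exists_bound_of_continuousOn
    (continuousOn_partialDeriv hF i)
  refine ⟨C + ∑ i, M i, fun m hm x hx => ?_⟩
  have h1 : |∑ i, partialDeriv i F x * (1 / 2 * scaledAbsDiff m x i)| ≤ ∑ i, M i := by
    refine (Finset.abs_sum_le_sum_abs _ _).trans (Finset.sum_le_sum fun i _ => ?_)
    obtain ⟨hs0, hs1⟩ := scaledAbsDiff_mem (m := m) hx i
    rw [abs_mul, abs_of_nonneg (by positivity : 0 ≤ 1 / 2 * scaledAbsDiff m x i)]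
    exact (mul_le_of_le_one_right (abs_nonneg _) (by linarith)).trans (hM i x hx)
  have h2 : C / √m ≤ C := div_le_self hC (Real.one_le_sqrt.2 (by exact_mod_cast hm))
  have h3 := h m hm x hx
  rw [abs_le] at *
  constructor <;> linarith

lemma tendsto_integral_bernsteinVar (hF : ContDiffOn ℝ 2 F (simplex d))
    (h01 : ∀ y, 0 ≤ F y ∧ F y ≤ 1) :
    Tendsto (fun m : ℕ => √m * ((∫ x in simplex d, bernsteinVar F m x) - intSigmaSq F)) atTop
      (𝓝 (-intV F)) := by
  obtain ⟨C, h⟩ := exists_abs_sqrt_mul_bernsteinVar_sub_le hF h01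
  have hS : IntegrableOn (sigmaSq F) (simplex d) :=
    (continuousOn_sigmaSq hF).integrableOn_compact (isCompact_simplex d)
  have hW : ∀ m, IntegrableOn (bernsteinVar F m) (simplex d) := fun m =>
    (continuous_bernsteinVar F m).continuousOn.integrableOn_compact (isCompact_simplex d)
  have e : ∀ m : ℕ, √m * ((∫ x in simplex d, bernsteinVar F m x) - intSigmaSq F)
      = ∫ x in simplex d, √m * (bernsteinVar F m x - sigmaSq F x) := fun m => by
    rw [integral_const_mul, integral_sub (hW m) hS, intSigmaSq]
  simp only [e]
  rw [intV, ← integral_neg]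
  refine tendsto_integral_filter_of_dominated_convergence (fun _ => C) ?_ ?_
    (integrable_const C) ?_
  · exact .of_forall fun m => (((hW m).sub hS).const_mul _).aestronglyMeasurable
  · filter_upwards [eventually_ge_atTop 1] with m hm
    filter_upwards [ae_restrict_mem (measurableSet_simplex d)] with x hx
    exact h m hm x hx
  · filter_upwards [ae_restrict_mem (measurableSet_simplex d)] with x hx
    exact tendsto_sqrt_mul_bernsteinVar_sub hF h01 hx

lemma tendsto_integral_bernsteinPoly_sub_sq (hF : ContDiffOn ℝ 2 F (simplex d)) :
    Tendsto (fun m : ℕ => (m : ℝ) ^ 2 * ∫ x in simplex d, (bernsteinPoly F m x - F x) ^ 2) atTop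
      (𝓝 (intBSq F)) := by
  obtain ⟨C, hC, h⟩ := exists_abs_bernsteinPoly_sub_le hF
  have e : ∀ m : ℕ, (m : ℝ) ^ 2 * ∫ x in simplex d, (bernsteinPoly F m x - F x) ^ 2
      = ∫ x in simplex d, ((m : ℝ) * (bernsteinPoly F m x - F x)) ^ 2 := fun m => by
    rw [← integral_const_mul]; simp only [mul_pow]
  simp only [e]
  refine tendsto_integral_filter_of_dominated_convergence (fun _ => C ^ 2) ?_ ?_
    (integrable_const _) ?_
  · refine .of_forall fun m => ContinuousOn.aestronglyMeasurable ?_ (measurableSet_simplex d)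
    exact (continuousOn_const.mul
      ((continuous_bernsteinPoly F m).continuousOn.sub hF.continuousOn)).pow 2
  · filter_upwards [eventually_ge_atTop 1] with m hm
    filter_upwards [ae_restrict_mem (measurableSet_simplex d)] with x hx
    have hm0 : (0 : ℝ) < m := by exact_mod_cast hm
    have h1 : |(m : ℝ) * (bernsteinPoly F m x - F x)| ≤ C := by
      rw [abs_mul, abs_of_pos hm0, mul_comm, ← le_div_iff₀ hm0]
      exact h m hm x hx
    rw [norm_pow, Real.norm_eq_abs]
    gcongr
  · filter_upwards [ae_restrict_mem (measurableSet_simplex d)] with x hx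
    exact (tendsto_mul_bernsteinPoly_sub hF hx).pow 2

end asymptotics

/-! ### Positivity of the leading coefficients -/

section positivity
variable {d : ℕ} {F : (Fin d → ℝ) → ℝ}

lemma monotone_jointCDF (μ : Measure (Fin d → ℝ)) [IsProbabilityMeasure μ] :
    Monotone (jointCDF μ) := fun _ _ h => measureReal_mono (Set.Iic_subset_Iic.2 h)

lemma hasFDerivAt_of_mem_interior (hF : ContDiffOn ℝ 2 F (simplex d)) {x : Fin d → ℝ}
    (hx : x ∈ interior (simplex d)) :
    HasFDerivAt F (fderivWithin ℝ F (simplex d) x) x :=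
  (hF.differentiableOn two_ne_zero x (interior_subset hx)).hasFDerivWithinAt.hasFDerivAt
    (mem_interior_iff_mem_nhds.1 hx)

lemma partialDeriv_nonneg (hF : ContDiffOn ℝ 2 F (simplex d)) (hmono : Monotone F)
    {x : Fin d → ℝ} (hx : x ∈ interior (simplex d)) (i : Fin d) : 0 ≤ partialDeriv i F x := by
  have h1 : HasDerivAt (fun t : ℝ => x + t • (Pi.single i 1 : Fin d → ℝ)) (Pi.single i 1) 0 := by
    simpa using ((hasDerivAt_id (0 : ℝ)).smul_const (Pi.single i 1 : Fin d → ℝ)).const_add x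
  have h0 : HasFDerivAt F (fderivWithin ℝ F (simplex d) x)
      (x + (0 : ℝ) • (Pi.single i 1 : Fin d → ℝ)) := by
    simpa using hasFDerivAt_of_mem_interior hF hx
  have h2 := h0.comp_hasDerivAt 0 h1
  have hg : Monotone (F ∘ fun t : ℝ => x + t • (Pi.single i 1 : Fin d → ℝ)) := by
    refine hmono.comp fun s t hst => ?_
    have : (0 : Fin d → ℝ) ≤ Pi.single i 1 := by simp
    gcongr
  exact h2.nonneg_of_monotone hg

lemma biasTerm_eq_zero (hF : ContDiffOn ℝ 2 F (simplex d)) {φ : (Fin d → ℝ) →L[ℝ] ℝ}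
    (h : ∀ x ∈ interior (simplex d), fderivWithin ℝ F (simplex d) x = φ) {x : Fin d → ℝ}
    (hx : x ∈ interior (simplex d)) : biasTerm F x = 0 := by
  have h2 : fderivWithin ℝ (fderivWithin ℝ F (simplex d)) (simplex d) x = 0 := by
    have hn : interior (simplex d) ∈ 𝓝 x := isOpen_interior.mem_nhds hx
    have he : fderivWithin ℝ F (simplex d) =ᶠ[𝓝 x] fun _ => φ := by
      filter_upwards [hn] with y hy using h y hy
    rw [fderivWithin_of_mem_nhds (mem_interior_iff_mem_nhds.1 hx), he.fderiv_eq]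
    simp
  simp [biasTerm, partialDeriv_partialDeriv hF (interior_subset hx), h2]

/-- Used contrapositively, with `φ = 0` for the positivity of ∫V and with the slope of an affine F
for that of the squared bias. -/
lemma intBSq_eq_zero (hF : ContDiffOn ℝ 2 F (simplex d)) {φ : (Fin d → ℝ) →L[ℝ] ℝ}
    (h : ∀ x ∈ interior (simplex d), fderivWithin ℝ F (simplex d) x = φ) : intBSq F = 0 := by
  rw [intBSq, ← setIntegral_congr_set (interior_simplex_ae_eq d),
    setIntegral_congr_fun isOpen_interior.measurableSet
      (g := fun _ => 0) fun x hx => by simp [biasTerm_eq_zero hF h hx]]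
  simp

lemma eqOn_interior_of_setIntegral_eq_zero {g : (Fin d → ℝ) → ℝ}
    (hg : ContinuousOn g (simplex d)) (h0 : ∀ x ∈ interior (simplex d), 0 ≤ g x)
    (h : ∫ x in simplex d, g x = 0) {x : Fin d → ℝ} (hx : x ∈ interior (simplex d)) : g x = 0 := by
  rw [← setIntegral_congr_set (interior_simplex_ae_eq d)] at h
  have hi : IntegrableOn g (interior (simplex d)) :=
    (hg.integrableOn_compact (isCompact_simplex d)).mono_set interior_subset
  have hae : ∀ᵐ x ∂volume.restrict (interior (simplex d)), 0 ≤ g x := by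
    filter_upwards [ae_restrict_mem isOpen_interior.measurableSet] with y hy using h0 y hy
  have := (integral_eq_zero_iff_of_nonneg_ae hae hi).1 h
  exact Measure.eqOn_open_of_ae_eq this isOpen_interior (hg.mono interior_subset)
    continuousOn_const hx

/-- Monotonicity of F makes V nonnegative. If ∫V were zero, each summand would vanish in the
interior, where the square-root weights are positive; the gradient would be zero there, and so would
B. -/
lemma intV_pos (hF : ContDiffOn ℝ 2 F (simplex d)) (hmono : Monotone F) (hB : 0 < intBSq F) :
    0 < intV F := by
  have hterm : ∀ x ∈ interior (simplex d), ∀ i ∈ Finset.univ,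
      0 ≤ partialDeriv i F x * √(x i * (1 - x i) / Real.pi) := fun x hx i _ =>
    mul_nonneg (partialDeriv_nonneg hF hmono hx i) (Real.sqrt_nonneg _)
  have h0 : ∀ x ∈ interior (simplex d), 0 ≤ varTerm F x := fun x hx =>
    Finset.sum_nonneg (hterm x hx)
  have hnn : 0 ≤ intV F := by
    rw [intV, ← setIntegral_congr_set (interior_simplex_ae_eq d)]
    exact setIntegral_nonneg isOpen_interior.measurableSet h0
  refine lt_of_le_of_ne hnn fun heq => hB.ne' ?_
  refine intBSq_eq_zero hF (φ := 0) fun x hx => ?_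
  have hV := eqOn_interior_of_setIntegral_eq_zero (continuousOn_varTerm hF) h0 heq.symm hx
  ext v
  rw [clm_apply_eq_sum]
  refine Finset.sum_eq_zero fun i _ => ?_
  have h1 := (Finset.sum_eq_zero_iff_of_nonneg (hterm x hx)).1 hV i (Finset.mem_univ i)
  obtain ⟨hi0, hi1⟩ := mem_Ioo_of_mem_interior hx i
  have hs : √(x i * (1 - x i) / Real.pi) ≠ 0 :=
    (Real.sqrt_pos.2 (div_pos (mul_pos hi0 (by linarith)) Real.pi_pos)).ne'
  have h2 : partialDeriv i F x = 0 := (mul_eq_zero.1 h1).resolve_right hs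
  rw [partialDeriv] at h2
  rw [h2, zero_mul]

lemma zero_mem_simplex : (0 : Fin d → ℝ) ∈ simplex d := by simp [simplex, norm1]

/-- Maximum principle for the Bernstein operator. -/
lemma nonpos_of_bernsteinPoly_eq {G : (Fin d → ℝ) → ℝ} {m : ℕ} (hm : 1 ≤ m)
    (hG : ContinuousOn G (simplex d)) (hfix : ∀ x ∈ simplex d, bernsteinPoly G m x = G x)
    (h0 : G 0 = 0) (h1 : ∀ i, G (Pi.single i 1) = 0) {x : Fin d → ℝ} (hx : x ∈ simplex d) :
    G x ≤ 0 := by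
  have hm0 : (m : ℝ) ≠ 0 := by positivity
  obtain ⟨y, hy, hmax⟩ := (isCompact_simplex d).exists_isMaxOn ⟨0, zero_mem_simplex⟩ hG
  suffices hGy : G y = 0 from (hmax hx).trans hGy.le
  have hsum : multinomialMean m y (fun k => G y - G (fun i => (k i : ℝ) / m)) = 0 := by
    rw [multinomialMean_sub, multinomialMean_const _ _ hy, ← bernsteinPoly_eq_multinomialMean,
      hfix y hy, sub_self]
  -- At a maximiser `y` a mean of nonnegative gaps is zero, so G(k/m) = G(y) for every `k` of
  -- nonzero weight. It remains to find a vertex of nonzero weight.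
  have hzero := (Finset.sum_eq_zero_iff_of_nonneg fun k hk => mul_nonneg
    (sub_nonneg.2 (hmax (div_mem_simplex (mem_multiIndices.1 hk))))
    (multinomialWeight_nonneg k hy)).1 hsum
  have key : ∀ k ∈ multiIndices d m, multinomialWeight m k y ≠ 0 →
      G (fun i => (k i : ℝ) / m) = 0 → G y = 0 := fun k hk hw hGk => by
    have := (mul_eq_zero.1 (hzero k hk)).resolve_right hw
    linarith
  -- On the face `norm1 y = 1` some vertex e_i has weight (y_i)^m ≠ 0; off it the origin has weight
  -- (1 - norm1 y)^m ≠ 0.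
  by_cases hn : norm1 y = 1
  · have : ∃ i, y i ≠ 0 := by
      by_contra! hall
      simp [norm1, hall] at hn
    obtain ⟨i, hi⟩ := this
    refine key (Pi.single i m) (by simp [mem_multiIndices]) ?_ ?_
    · have hp : ∏ j, y j ^ (Pi.single i m : Fin d → ℕ) j = y i ^ m := by
        rw [Finset.prod_eq_single i] <;> simp +contextual
      have hf : ∏ j, (((Pi.single i m : Fin d → ℕ) j).factorial : ℝ) = m.factorial := by
        rw [Finset.prod_eq_single i] <;> simp +contextual
      rw [multinomialWeight, hp, hf]
      simp [hi, Nat.factorial_ne_zero]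
    · convert h1 i using 2
      ext j
      rcases eq_or_ne j i with rfl | h <;> simp [*]
  · refine key 0 (by simp [mem_multiIndices]) ?_ ?_
    · simp [multinomialWeight, Nat.factorial_ne_zero, sub_eq_zero, Ne.symm hn]
    · convert h0 using 2
      ext j; simp

/-- The affine interpolant at the vertices is itself fixed by the operator, so the maximum principle
applies to F - A and to A - F. -/
lemma eq_affine_of_bernsteinPoly_eq {m : ℕ} (hm : 1 ≤ m) (hF : ContinuousOn F (simplex d))
    (hfix : ∀ x ∈ simplex d, bernsteinPoly F m x = F x) {x : Fin d → ℝ} (hx : x ∈ simplex d) :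
    F x = F 0 + ∑ i, (F (Pi.single i 1) - F 0) * x i := by
  set A : (Fin d → ℝ) → ℝ := fun x => F 0 + ∑ i, (F (Pi.single i 1) - F 0) * x i with hA
  have hAc : Continuous A := by fun_prop
  have hA0 : A 0 = F 0 := by simp [hA]
  have hA1 : ∀ i, A (Pi.single i 1) = F (Pi.single i 1) := fun i => by
    simp [hA, Pi.single_apply]
  have hAfix : ∀ x ∈ simplex d, multinomialMean m x (fun k => A fun i => (k i : ℝ) / m) = A x := by
    intro x hx
    have hk : ∀ i, multinomialMean m x (fun k => (k i : ℝ) / m) = x i := fun i => by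
      have := multinomialMean_div_sub hm hx i
      rwa [multinomialMean_sub, multinomialMean_const _ _ hx, sub_eq_zero] at this
    simp only [hA, multinomialMean_add, multinomialMean_const _ _ hx, multinomialMean_sum,
      multinomialMean_const_mul, hk]
  have hle := nonpos_of_bernsteinPoly_eq (G := fun x => F x - A x) hm (hF.sub hAc.continuousOn)
    (fun x hx => by
      rw [bernsteinPoly_eq_multinomialMean, multinomialMean_sub, hAfix x hx,
        ← bernsteinPoly_eq_multinomialMean, hfix x hx])
    (by simp [hA0]) (fun i => by simp [hA1]) hx
  have hge := nonpos_of_bernsteinPoly_eq (G := fun x => A x - F x) hm (hAc.continuousOn.sub hF)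
    (fun x hx => by
      rw [bernsteinPoly_eq_multinomialMean, multinomialMean_sub, hAfix x hx,
        ← bernsteinPoly_eq_multinomialMean, hfix x hx])
    (by simp [hA0]) (fun i => by simp [hA1]) hx
  have : F x = A x := by linarith
  exact this

/-- Rules out bounded bandwidths: zero squared bias would make F affine on the simplex, hence B = 0.
-/
lemma integral_bernsteinPoly_sub_sq_pos (hF : ContDiffOn ℝ 2 F (simplex d)) (hB : 0 < intBSq F)
    {m : ℕ} (hm : 1 ≤ m) : 0 < ∫ x in simplex d, (bernsteinPoly F m x - F x) ^ 2 := by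
  have hc : ContinuousOn (fun x => bernsteinPoly F m x - F x) (simplex d) :=
    (continuous_bernsteinPoly F m).continuousOn.sub hF.continuousOn
  refine lt_of_le_of_ne (integral_nonneg fun x => sq_nonneg _) fun heq => hB.ne' ?_
  have hint : ∀ x ∈ interior (simplex d), bernsteinPoly F m x - F x = 0 := fun x hx =>
    pow_eq_zero_iff two_ne_zero |>.1 (eqOn_interior_of_setIntegral_eq_zero
      (hc.pow 2) (fun _ _ => sq_nonneg _) heq.symm hx)
  have hfix : ∀ x ∈ simplex d, bernsteinPoly F m x = F x := fun x hx =>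
    sub_eq_zero.1 (Set.EqOn.of_subset_closure (f := fun x => bernsteinPoly F m x - F x)
      (g := fun _ => (0 : ℝ)) (s := interior (simplex d)) (t := simplex d) hint hc
      continuousOn_const interior_subset (simplex_subset_closure_interior d) hx)
  set φ : (Fin d → ℝ) →L[ℝ] ℝ :=
    ∑ i, (F (Pi.single i 1) - F 0) • ContinuousLinearMap.proj (R := ℝ) (φ := fun _ => ℝ) i with hφ
  refine intBSq_eq_zero hF (φ := φ) fun x hx => ?_
  have haff : Set.EqOn F (fun x => F 0 + φ x) (simplex d) := fun y hy => by
    rw [eq_affine_of_bernsteinPoly_eq hm hF.continuousOn hfix hy]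
    simp [hφ]
  rw [fderivWithin_congr haff (haff (interior_subset hx)),
    ((φ.hasFDerivAt (x := x)).const_add (F 0)).hasFDerivWithinAt.fderivWithin
      (uniqueDiffOn_simplex d x (interior_subset hx))]

end positivity

/-! ### Optimisation of the bandwidth -/

lemma rpow_neg_half {t : ℝ} (ht : 0 ≤ t) : t ^ (-(1 / 2) : ℝ) = (√t)⁻¹ := by
  rw [Real.rpow_neg ht, Real.sqrt_eq_rpow]

lemma rpow_neg_two {t : ℝ} (ht : 0 ≤ t) : t ^ (-2 : ℝ) = (t ^ 2)⁻¹ := by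
  rw [Real.rpow_neg ht, Real.rpow_two]

section risk
variable {R : ℕ → ℕ → ℝ} {W b : ℕ → ℝ} {σ V B : ℝ}

/-- This section treats an abstract risk: `W` stands for the integrated variance factor and `b` for
the integrated squared bias. -/
lemma exists_isLittleO_expansion (hR : ∀ n, 1 ≤ n → ∀ k, R n k = (n : ℝ)⁻¹ * W k + b k)
    (hW : Tendsto (fun k : ℕ => √k * (W k - σ)) atTop (𝓝 (-V)))
    (hb : Tendsto (fun k : ℕ => (k : ℝ) ^ 2 * b k) atTop (𝓝 B))
    {m : ℕ → ℕ} (hm : Tendsto m atTop atTop) :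
    ∃ r₁ r₂ : ℕ → ℝ, r₁ =o[atTop] (fun n : ℕ => (n : ℝ)⁻¹ * (m n : ℝ) ^ (-(1 / 2) : ℝ)) ∧
      r₂ =o[atTop] (fun n : ℕ => (m n : ℝ) ^ (-2 : ℝ)) ∧
      ∀ n, R n (m n) = (n : ℝ)⁻¹ * σ - (n : ℝ)⁻¹ * (m n : ℝ) ^ (-(1 / 2) : ℝ) * V
        + (m n : ℝ) ^ (-2 : ℝ) * B + r₁ n + r₂ n := by
  have hev : ∀ᶠ n in atTop, 1 ≤ n ∧ 1 ≤ m n :=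
    (eventually_ge_atTop 1).and (hm.eventually_ge_atTop 1)
  set r₂ : ℕ → ℝ := fun n => (m n : ℝ) ^ (-2 : ℝ) * ((m n : ℝ) ^ 2 * b (m n) - B) with hr₂
  -- Defined as the leftover, so that the expansion holds for every `n`, including `n = 0`; its size
  -- matters only eventually.
  set r₁ : ℕ → ℝ := fun n => R n (m n) - ((n : ℝ)⁻¹ * σ
    - (n : ℝ)⁻¹ * (m n : ℝ) ^ (-(1 / 2) : ℝ) * V + (m n : ℝ) ^ (-2 : ℝ) * B) - r₂ n with hr₁
  have hr₁' : r₁ =ᶠ[atTop] fun n => (n : ℝ)⁻¹ * (m n : ℝ) ^ (-(1 / 2) : ℝ) *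
      (√(m n) * (W (m n) - σ) + V) := by
    filter_upwards [hev] with n hn
    have h0 : (0 : ℝ) < m n := by exact_mod_cast hn.2
    have hs : √(m n : ℝ) ≠ 0 := (Real.sqrt_pos.2 h0).ne'
    simp only [hr₁, hr₂]
    rw [hR n hn.1, rpow_neg_half h0.le, rpow_neg_two h0.le]
    field_simp
    ring
  refine ⟨r₁, r₂, ?_, ?_, fun n => by simp only [hr₁]; ring⟩
  · have h1 : (fun n => √(m n) * (W (m n) - σ) + V) =o[atTop] fun _ => (1 : ℝ) := by
      rw [isLittleO_one_iff]
      simpa using (hW.comp hm).add_const V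
    refine IsLittleO.congr' ?_ hr₁'.symm EventuallyEq.rfl
    simpa using (isBigO_refl (fun n : ℕ => (n : ℝ)⁻¹ * (m n : ℝ) ^ (-(1 / 2) : ℝ))
      atTop).mul_isLittleO h1
  · have h1 : (fun n => (m n : ℝ) ^ 2 * b (m n) - B) =o[atTop] fun _ => (1 : ℝ) := by
      rw [isLittleO_one_iff]
      simpa using (hb.comp hm).sub_const B
    simpa [hr₂] using (isBigO_refl (fun n : ℕ => (m n : ℝ) ^ (-2 : ℝ)) atTop).mul_isLittleO h1

/-- The real bandwidth `n^{2/3} (4B/V)^{2/3}`. -/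
noncomputable def optBandwidth (V B : ℝ) (n : ℕ) : ℝ :=
  (n : ℝ) ^ (2 / 3 : ℝ) * (4 * B / V) ^ (2 / 3 : ℝ)

variable (hV : 0 < V) (hB : 0 < B)
include hV hB

lemma optBandwidth_pos {n : ℕ} (hn : 1 ≤ n) : 0 < optBandwidth V B n := by
  have : (0 : ℝ) < n := by exact_mod_cast hn
  unfold optBandwidth
  positivity

/-- The stationarity equation T^{3/2} V = 4nB, used below to eliminate `n`. -/
lemma optBandwidth_mul_sqrt {n : ℕ} (hn : 1 ≤ n) :
    optBandwidth V B n * √(optBandwidth V B n) * V = n * (4 * B) := by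
  have hT := optBandwidth_pos hV hB hn
  have h0 : (0 : ℝ) ≤ n := n.cast_nonneg
  have e : optBandwidth V B n * √(optBandwidth V B n) = optBandwidth V B n ^ (3 / 2 : ℝ) := by
    rw [Real.sqrt_eq_rpow]
    nth_rewrite 1 [← Real.rpow_one (optBandwidth V B n)]
    rw [← Real.rpow_add hT]
    norm_num
  rw [e, optBandwidth, ← Real.mul_rpow h0 (by positivity), ← Real.rpow_mul (by positivity)]
  norm_num
  field_simp

lemma tendsto_optBandwidth : Tendsto (optBandwidth V B) atTop atTop :=
  ((tendsto_rpow_atTop (by norm_num)).comp tendsto_natCast_atTop_atTop).atTop_mul_const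
    (by positivity)

lemma optBandwidth_sq_mul {n : ℕ} (hn : 1 ≤ n) :
    optBandwidth V B n ^ 2 * (n : ℝ) ^ (-(4 / 3) : ℝ) = (4 * B / V) ^ (4 / 3 : ℝ) := by
  have h0 : (0 : ℝ) < n := by exact_mod_cast hn
  rw [optBandwidth, mul_pow, ← Real.rpow_mul_natCast h0.le, ← Real.rpow_mul_natCast (by positivity),
    mul_right_comm, ← Real.rpow_add h0]
  norm_num

/-- T² n^{-4/3} is a positive constant, so errors at scale n^{-4/3} are those that vanish after
multiplication by T². -/
lemma isLittleO_rpow_iff {f : ℕ → ℝ} : (f =o[atTop] fun n : ℕ => (n : ℝ) ^ (-(4 / 3) : ℝ)) ↔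
    Tendsto (fun n => optBandwidth V B n ^ 2 * f n) atTop (𝓝 0) := by
  have hq : 0 < (4 * B / V) ^ (4 / 3 : ℝ) := by positivity
  have hpos : ∀ᶠ n : ℕ in atTop, 0 < (n : ℝ) ^ (-(4 / 3) : ℝ) := by
    filter_upwards [eventually_ge_atTop 1] with n hn
    have : (0 : ℝ) < n := by exact_mod_cast hn
    positivity
  rw [isLittleO_iff_tendsto' (hpos.mono fun n hn h => absurd h hn.ne')]
  have e : (fun n => optBandwidth V B n ^ 2 * f n) =ᶠ[atTop]
      fun n => (4 * B / V) ^ (4 / 3 : ℝ) * (f n / (n : ℝ) ^ (-(4 / 3) : ℝ)) := by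
    filter_upwards [eventually_ge_atTop 1, hpos] with n hn hn'
    rw [← optBandwidth_sq_mul hV hB hn]
    field_simp
  rw [tendsto_congr' e]
  constructor
  · intro h; simpa using h.const_mul ((4 * B / V) ^ (4 / 3 : ℝ))
  · intro h
    have := h.const_mul ((4 * B / V) ^ (4 / 3 : ℝ))⁻¹
    simpa [← mul_assoc, inv_mul_cancel₀ hq.ne'] using this

/-- In u = √(T/k) the variance part is linear and the squared bias quartic; for large `k` their
coefficients approach -4B and B. -/
lemma scaled_risk_eq (hR : ∀ n, 1 ≤ n → ∀ k, R n k = (n : ℝ)⁻¹ * W k + b k)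
    {n k : ℕ} (hn : 1 ≤ n) (hk : 1 ≤ k) :
    optBandwidth V B n ^ 2 * (R n k - (n : ℝ)⁻¹ * σ)
      = 4 * B * ((√k * (W k - σ)) / V) * √(optBandwidth V B n / k)
        + ((k : ℝ) ^ 2 * b k) * √(optBandwidth V B n / k) ^ 4 := by
  have hT := optBandwidth_pos hV hB hn
  have hTs := optBandwidth_mul_sqrt hV hB hn
  set T := optBandwidth V B n
  have hk0 : (0 : ℝ) < k := by exact_mod_cast hk
  have hn0 : (0 : ℝ) < n := by exact_mod_cast hn
  have hs : √(k : ℝ) ≠ 0 := (Real.sqrt_pos.2 hk0).ne'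
  have h4 : √(T / k) ^ 4 = (T / k) ^ 2 := by
    rw [show √(T / k) ^ 4 = (√(T / k) ^ 2) ^ 2 by ring, Real.sq_sqrt (by positivity)]
  rw [hR n hn, h4, Real.sqrt_div hT.le]
  have hTT : √T * √T = T := Real.mul_self_sqrt hT.le
  have h1 : T ^ 2 * ((n : ℝ)⁻¹ * (W k - σ)) = 4 * B * (√T * (W k - σ) / V) := by
    field_simp
    linear_combination (W k - σ) * (√T * hTs - T * V * hTT)
  have h2 : 4 * B * (√k * (W k - σ) / V) * (√T / √k) = 4 * B * (√T * (W k - σ) / V) := by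
    field_simp
  rw [h2, ← h1]
  field_simp
  ring

/-- Uniform lower bound of the rescaled risk, quadratic in the deviation from the optimum. -/
lemma eventually_scaled_risk_ge (hR : ∀ n, 1 ≤ n → ∀ k, R n k = (n : ℝ)⁻¹ * W k + b k)
    (hW : Tendsto (fun k : ℕ => √k * (W k - σ)) atTop (𝓝 (-V)))
    (hb : Tendsto (fun k : ℕ => (k : ℝ) ^ 2 * b k) atTop (𝓝 B))
    (hbpos : ∀ k, 1 ≤ k → 0 < b k) {ε : ℝ} (hε : 0 < ε) :
    ∀ᶠ n : ℕ in atTop, ∀ k : ℕ, 1 ≤ k → B * (√(optBandwidth V B n / k) - 1) ^ 2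
      ≤ optBandwidth V B n ^ 2 * (R n k - (n : ℝ)⁻¹ * σ) + 3 * B + ε := by
  -- With Q = u⁴ - 4u + 3 and u + u⁴ ≤ 6Q + 50, the errors in the coefficients cost at most (2/3)BQ
  -- + ε, and the remaining BQ/3 is at least B(u - 1)².
  obtain ⟨η, hη, hη1, hη2⟩ : ∃ η > 0, η ≤ B / 9 ∧ 50 * η ≤ ε :=
    ⟨min (B / 9) (ε / 50), by positivity, min_le_left _ _, by
      have := min_le_right (B / 9) (ε / 50); linarith⟩
  have hW' : Tendsto (fun k : ℕ => 4 * B * ((√k * (W k - σ)) / V)) atTop (𝓝 (-(4 * B))) := by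
    have := (hW.div_const V).const_mul (4 * B)
    rwa [neg_div, div_self hV.ne', mul_neg_one] at this
  obtain ⟨K, hK⟩ := eventually_atTop.1 ((hW'.eventually_const_le
    (show -(4 * B) - η < -(4 * B) by linarith)).and (hb.eventually_const_le
    (show B - η < B by linarith)))
  have hTinf := tendsto_optBandwidth hV hB
  -- For the finitely many `k < K`, `b k > 0` wins: multiplied by T², the subtracted term is B(1 +
  -- T), which bounds B(u - 1)² because u² ≤ T.
  have hsmall : ∀ᶠ n : ℕ in atTop, ∀ k ∈ Finset.Ico 1 K,
      0 < (n : ℝ)⁻¹ * (W k - σ) + b k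
        - B * ((optBandwidth V B n)⁻¹ ^ 2 + (optBandwidth V B n)⁻¹) := by
    rw [Finset.eventually_all]
    intro k hk
    have h1 : Tendsto (fun n : ℕ => (n : ℝ)⁻¹ * (W k - σ) + b k
        - B * ((optBandwidth V B n)⁻¹ ^ 2 + (optBandwidth V B n)⁻¹)) atTop
        (𝓝 (0 * (W k - σ) + b k - B * (0 ^ 2 + 0))) :=
      ((tendsto_inv_atTop_nhds_zero_nat.mul_const _).add_const _).sub
        (((hTinf.inv_tendsto_atTop.pow 2).add hTinf.inv_tendsto_atTop).const_mul B)
    refine h1.eventually_const_lt ?_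
    simpa using hbpos k (Finset.mem_Ico.1 hk).1
  filter_upwards [hsmall, eventually_ge_atTop 1] with n hn hn1 k hk
  have hT := optBandwidth_pos hV hB hn1
  have hk0 : (1 : ℝ) ≤ k := by exact_mod_cast hk
  set T := optBandwidth V B n
  set u := √(T / k) with hu
  have hu0 : 0 ≤ u := Real.sqrt_nonneg _
  rcases lt_or_ge k K with h | h
  · have h1 := hn k (Finset.mem_Ico.2 ⟨hk, h⟩)
    have h2 : u ^ 2 ≤ T := by
      rw [hu, Real.sq_sqrt (by positivity)]
      exact div_le_self hT.le hk0
    have h3 : B * (u - 1) ^ 2 ≤ B * (1 + T) := by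
      gcongr
      nlinarith
    have h4 : 0 < T ^ 2 * ((n : ℝ)⁻¹ * (W k - σ) + b k - B * (T⁻¹ ^ 2 + T⁻¹)) := by positivity
    have h5 : T ^ 2 * ((n : ℝ)⁻¹ * (W k - σ) + b k - B * (T⁻¹ ^ 2 + T⁻¹))
        = T ^ 2 * (R n k - (n : ℝ)⁻¹ * σ) - B * (1 + T) := by
      rw [hR n hn1]
      field_simp
      ring
    linarith
  · rw [scaled_risk_eq hV hB hR hn1 hk]
    obtain ⟨h1, h2⟩ := hK k h
    have h3 : (-(4 * B) - η) * u ≤ 4 * B * ((√k * (W k - σ)) / V) * u := by gcongr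
    have h4 : (B - η) * u ^ 4 ≤ (k : ℝ) ^ 2 * b k * u ^ 4 := by gcongr
    set Q := (u - 1) ^ 2 * (u ^ 2 + 2 * u + 3) with hQ
    have hQ' : Q = u ^ 4 - 4 * u + 3 := by rw [hQ]; ring
    have hQ3 : 3 * (u - 1) ^ 2 ≤ Q := by
      rw [hQ, mul_comm]
      gcongr
      nlinarith
    have hQ4 : u + u ^ 4 ≤ 6 * Q + 50 := by
      rw [hQ']
      nlinarith [sq_nonneg (u ^ 2 - 2), sq_nonneg (u - 2), sq_nonneg u]
    have hQ0 : 0 ≤ Q := by positivity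
    have h5 : η * (u + u ^ 4) ≤ B / 9 * (6 * Q) + ε := by
      calc η * (u + u ^ 4) ≤ η * (6 * Q + 50) := by gcongr
        _ = η * (6 * Q) + 50 * η := by ring
        _ ≤ B / 9 * (6 * Q) + ε := by gcongr
    have h6 : B * (3 * (u - 1) ^ 2) ≤ B * Q := by gcongr
    have h7 : (-(4 * B) - η) * u + (B - η) * u ^ 4 = B * Q - 3 * B - η * (u + u ^ 4) := by
      rw [hQ']; ring
    linarith

lemma tendsto_scaled_risk (hR : ∀ n, 1 ≤ n → ∀ k, R n k = (n : ℝ)⁻¹ * W k + b k)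
    (hW : Tendsto (fun k : ℕ => √k * (W k - σ)) atTop (𝓝 (-V)))
    (hb : Tendsto (fun k : ℕ => (k : ℝ) ^ 2 * b k) atTop (𝓝 B)) {m : ℕ → ℕ}
    (hm : Tendsto (fun n => (m n : ℝ) / optBandwidth V B n) atTop (𝓝 1)) :
    Tendsto (fun n : ℕ => optBandwidth V B n ^ 2 * (R n (m n) - (n : ℝ)⁻¹ * σ)) atTop
      (𝓝 (-(3 * B))) := by
  have hTinf := tendsto_optBandwidth hV hB
  have hminf : Tendsto m atTop atTop := by
    rw [← tendsto_natCast_atTop_iff (R := ℝ)]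
    refine (hm.pos_mul_atTop one_pos hTinf).congr' ?_
    filter_upwards [eventually_ge_atTop 1] with n hn
    exact div_mul_cancel₀ _ (optBandwidth_pos hV hB hn).ne'
  have hu : Tendsto (fun n => √(optBandwidth V B n / m n)) atTop (𝓝 1) := by
    have := (hm.inv₀ one_ne_zero).sqrt
    simpa using this
  have hW' : Tendsto (fun n => 4 * B * ((√(m n) * (W (m n) - σ)) / V)) atTop (𝓝 (-(4 * B))) := by
    have := (((hW.comp hminf).div_const V).const_mul (4 * B))
    rwa [neg_div, div_self hV.ne', mul_neg_one] at this
  have := (hW'.mul hu).add ((hb.comp hminf).mul (hu.pow 4))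
  rw [show -(4 * B) * 1 + B * 1 ^ 4 = -(3 * B) by ring] at this
  refine this.congr' ?_
  filter_upwards [eventually_ge_atTop 1, hminf.eventually_ge_atTop 1] with n hn hmn
  rw [scaled_risk_eq hV hB hR hn hmn]
  rfl

/-- Comparison with a rounding of T, whose scaled risk tends to -3B: optimality bounds the scaled
risk of `m` above by -3B + o(1), and the quadratic lower bound forces u → 1. -/
lemma tendsto_of_asymptoticallyOptimal
    (hR : ∀ n, 1 ≤ n → ∀ k, R n k = (n : ℝ)⁻¹ * W k + b k)
    (hW : Tendsto (fun k : ℕ => √k * (W k - σ)) atTop (𝓝 (-V)))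
    (hb : Tendsto (fun k : ℕ => (k : ℝ) ^ 2 * b k) atTop (𝓝 B))
    (hbpos : ∀ k, 1 ≤ k → 0 < b k) {m : ℕ → ℕ} (hm : ∀ n, 1 ≤ m n)
    (hopt : AsymptoticallyOptimal R (fun n : ℕ => (n : ℝ) ^ (-(4 / 3) : ℝ)) m) :
    Tendsto (fun n => (m n : ℝ) / optBandwidth V B n) atTop (𝓝 1) := by
  have hTinf := tendsto_optBandwidth hV hB
  -- Adding one keeps the competitor positive, even at `n = 0`.
  set m' : ℕ → ℕ := fun n => ⌊optBandwidth V B n⌋₊ + 1 with hm'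
  have hm'lim : Tendsto (fun n => (m' n : ℝ) / optBandwidth V B n) atTop (𝓝 1) := by
    have h1 := (tendsto_nat_floor_div_atTop (R := ℝ)).comp hTinf
    have h2 := h1.add hTinf.inv_tendsto_atTop
    rw [add_zero] at h2
    refine h2.congr fun n => ?_
    simp only [hm', Function.comp_apply, Pi.inv_apply]
    push_cast
    ring
  obtain ⟨r, hr, hle⟩ := hopt m' (fun n => by simp [hm'])
  have hr' := (isLittleO_rpow_iff hV hB).1 hr
  have hup := ((tendsto_scaled_risk hV hB hR hW hb hm'lim).add hr').add_const (3 * B)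
  rw [add_zero, neg_add_cancel] at hup
  have hsq : Tendsto (fun n => (√(optBandwidth V B n / m n) - 1) ^ 2) atTop (𝓝 0) := by
    rw [Metric.tendsto_atTop']
    intro ε hε
    have e1 := eventually_scaled_risk_ge hV hB hR hW hb hbpos (ε := B * ε / 2) (by positivity)
    have e2 := hup.eventually_lt_const (show (0 : ℝ) < B * ε / 2 by positivity)
    obtain ⟨N, hN⟩ := eventually_atTop.1 (e1.and e2)
    refine ⟨N, fun n hn => ?_⟩
    obtain ⟨h1, h2⟩ := hN n hn.le
    rw [Real.dist_0_eq_abs, abs_of_nonneg (sq_nonneg _)]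
    have h3 := h1 (m n) (hm n)
    have h4 : optBandwidth V B n ^ 2 * (R n (m n) - (n : ℝ)⁻¹ * σ)
        ≤ optBandwidth V B n ^ 2 * (R n (m' n) + r n - (n : ℝ)⁻¹ * σ) := by
      gcongr
      exact hle n
    have h5 : B * (√(optBandwidth V B n / m n) - 1) ^ 2 < B * ε := by linarith
    exact lt_of_mul_lt_mul_left h5 hB.le
  have hu : Tendsto (fun n => √(optBandwidth V B n / m n)) atTop (𝓝 1) := by
    have h1 := hsq.sqrt
    simp only [Real.sqrt_sq_eq_abs, Real.sqrt_zero] at h1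
    have h2 := ((tendsto_zero_iff_abs_tendsto_zero _).2 h1).add_const 1
    simpa using h2
  have := (hu.pow 2).inv₀ (by norm_num)
  rw [one_pow, inv_one] at this
  refine this.congr' ?_
  filter_upwards [eventually_ge_atTop 1] with n hn
  have hT := optBandwidth_pos hV hB hn
  rw [Real.sq_sqrt (by positivity), inv_div]

/-- The scaled risk of `m` tends to -3B, and eventually no competitor falls below -3B - ε, uniformly
in its value at `n`. The positive part of the difference serves as remainder. -/
lemma asymptoticallyOptimal_of_tendsto
    (hR : ∀ n, 1 ≤ n → ∀ k, R n k = (n : ℝ)⁻¹ * W k + b k)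
    (hW : Tendsto (fun k : ℕ => √k * (W k - σ)) atTop (𝓝 (-V)))
    (hb : Tendsto (fun k : ℕ => (k : ℝ) ^ 2 * b k) atTop (𝓝 B))
    (hbpos : ∀ k, 1 ≤ k → 0 < b k) {m : ℕ → ℕ}
    (hm : Tendsto (fun n => (m n : ℝ) / optBandwidth V B n) atTop (𝓝 1)) :
    AsymptoticallyOptimal R (fun n : ℕ => (n : ℝ) ^ (-(4 / 3) : ℝ)) m := by
  intro m' hm'
  refine ⟨fun n => max 0 (R n (m n) - R n (m' n)), ?_, fun n => by
    have := le_max_right 0 (R n (m n) - R n (m' n)); linarith⟩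
  rw [isLittleO_rpow_iff hV hB, Metric.tendsto_atTop']
  intro ε hε
  have e1 := eventually_scaled_risk_ge hV hB hR hW hb hbpos (ε := ε / 2) (by positivity)
  have e2 := (tendsto_scaled_risk hV hB hR hW hb hm).eventually_lt_const
    (show -(3 * B) < -(3 * B) + ε / 2 by linarith)
  obtain ⟨N, hN⟩ := eventually_atTop.1 (e1.and e2)
  refine ⟨N, fun n hn => ?_⟩
  obtain ⟨h1, h2⟩ := hN n hn.le
  have h3 := h1 (m' n) (hm' n)
  have h4 : 0 ≤ B * (√(optBandwidth V B n / m' n) - 1) ^ 2 := by positivity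
  rw [Real.dist_0_eq_abs, abs_of_nonneg (by positivity)]
  rcases max_choice 0 (R n (m n) - R n (m' n)) with h | h <;> rw [h]
  · simpa using hε
  · linarith

lemma risk_optBandwidth_isLittleO (hR : ∀ n, 1 ≤ n → ∀ k, R n k = (n : ℝ)⁻¹ * W k + b k)
    (hW : Tendsto (fun k : ℕ => √k * (W k - σ)) atTop (𝓝 (-V)))
    (hb : Tendsto (fun k : ℕ => (k : ℝ) ^ 2 * b k) atTop (𝓝 B)) {m : ℕ → ℕ}
    (hm : Tendsto (fun n => (m n : ℝ) / optBandwidth V B n) atTop (𝓝 1)) :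
    (fun n : ℕ => R n (m n) - ((n : ℝ)⁻¹ * σ - (n : ℝ) ^ (-(4 / 3) : ℝ) * (3 / 4)
      * (V ^ 4 / (4 * B)) ^ (1 / 3 : ℝ))) =o[atTop] fun n : ℕ => (n : ℝ) ^ (-(4 / 3) : ℝ) := by
  rw [isLittleO_rpow_iff hV hB]
  have h1 := (tendsto_scaled_risk hV hB hR hW hb hm).add_const (3 * B)
  rw [neg_add_cancel] at h1
  refine h1.congr' ?_
  filter_upwards [eventually_ge_atTop 1] with n hn
  have hq := optBandwidth_sq_mul hV hB hn
  -- Identifies 3/4 of the stated constant, after scaling by T², with the minimum depth 3B.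
  have hc : (4 * B / V) ^ (4 / 3 : ℝ) * (V ^ 4 / (4 * B)) ^ (1 / 3 : ℝ) = 4 * B := by
    have : (4 * B / V) ^ (4 / 3 : ℝ) = ((4 * B / V) ^ 4) ^ (1 / 3 : ℝ) := by
      rw [← Real.rpow_natCast_mul (by positivity)]; norm_num
    rw [this, ← Real.mul_rpow (by positivity) (by positivity)]
    have e : (4 * B / V) ^ 4 * (V ^ 4 / (4 * B)) = (4 * B) ^ 3 := by field_simp
    rw [e, ← Real.rpow_natCast_mul (by positivity)]
    norm_num
  rw [← hq] at hc
  linear_combination (-3 / 4) * hc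

/-- The explicit expansion is minimised at `optBandwidth` only. -/
lemma expansion_optBandwidth_lt {n : ℕ} (hn : 1 ≤ n) {t : ℝ} (ht : 0 < t)
    (hne : t ≠ optBandwidth V B n) :
    (n : ℝ)⁻¹ * σ - (n : ℝ)⁻¹ * optBandwidth V B n ^ (-(1 / 2) : ℝ) * V
        + optBandwidth V B n ^ (-2 : ℝ) * B
      < (n : ℝ)⁻¹ * σ - (n : ℝ)⁻¹ * t ^ (-(1 / 2) : ℝ) * V + t ^ (-2 : ℝ) * B := by
  have hT := optBandwidth_pos hV hB hn
  have hTs := optBandwidth_mul_sqrt hV hB hn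
  have hn0 : (0 : ℝ) < n := by exact_mod_cast hn
  set T := optBandwidth V B n
  rw [rpow_neg_half hT.le, rpow_neg_half ht.le, rpow_neg_two hT.le, rpow_neg_two ht.le]
  -- In c = t^{-1/2} the varying part is B(c⁴ - 4a³c), and its excess over the value at `a` factors
  -- as B(c - a)²((c + a)² + 2a²).
  set a := (√T)⁻¹ with ha
  set c := (√t)⁻¹ with hc
  have ha0 : 0 < a := inv_pos.2 (Real.sqrt_pos.2 hT)
  have hc0 : 0 < c := inv_pos.2 (Real.sqrt_pos.2 ht)
  have hTa : T = (a ^ 2)⁻¹ := by rw [ha, inv_pow, inv_inv, Real.sq_sqrt hT.le]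
  have htc : t = (c ^ 2)⁻¹ := by rw [hc, inv_pow, inv_inv, Real.sq_sqrt ht.le]
  have hac : c ≠ a := fun h => hne (by rw [htc, hTa, h])
  have hsT : √T = a⁻¹ := by rw [ha, inv_inv]
  rw [hsT, hTa] at hTs
  have hV' : (n : ℝ)⁻¹ * V = 4 * B * a ^ 3 := by
    field_simp at hTs ⊢
    linear_combination hTs
  have e1 : (T ^ 2)⁻¹ = a ^ 4 := by rw [hTa]; field_simp
  have e2 : (t ^ 2)⁻¹ = c ^ 4 := by rw [htc]; field_simp
  rw [e1, e2]
  have key : 0 < B * ((c - a) ^ 2 * ((c + a) ^ 2 + 2 * a ^ 2)) := by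
    have : 0 < (c - a) ^ 2 := by
      have := sub_ne_zero.2 hac
      positivity
    positivity
  have h3 : B * ((c - a) ^ 2 * ((c + a) ^ 2 + 2 * a ^ 2))
      = (-(c * (4 * B * a ^ 3)) + c ^ 4 * B) - (-(a * (4 * B * a ^ 3)) + a ^ 4 * B) := by ring
  rw [← hV'] at h3
  linarith

end risk

end BernsteinSimplex

/-! ### The theorem -/

theorem mainTheorem5 {d : ℕ} (hd : 1 ≤ d)
    (μ : Measure (Fin d → ℝ)) [IsProbabilityMeasure μ]
    (hF : ContDiffOn ℝ 2 (BernsteinSimplex.jointCDF μ) (BernsteinSimplex.simplex d))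
    {Ω : Type*} [MeasurableSpace Ω] (P : Measure Ω) [IsProbabilityMeasure P]
    (X : ℕ → Ω → Fin d → ℝ) (hlaw : ∀ i, HasLaw (X i) μ P) (hindep : iIndepFun X P) :
    -- the expansion, for every bandwidth sequence `m = m(n) → ∞`
    (∀ m : ℕ → ℕ, Tendsto m atTop atTop →
      ∃ r₁ r₂ : ℕ → ℝ,
        r₁ =o[atTop] (fun n : ℕ => (n : ℝ)⁻¹ * (m n : ℝ) ^ (-(1 / 2) : ℝ)) ∧
        r₂ =o[atTop] (fun n : ℕ => (m n : ℝ) ^ (-2 : ℝ)) ∧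
        ∀ n, BernsteinSimplex.MISE P X (BernsteinSimplex.jointCDF μ) n (m n)
          = (n : ℝ)⁻¹ * BernsteinSimplex.intSigmaSq (BernsteinSimplex.jointCDF μ)
            - (n : ℝ)⁻¹ * (m n : ℝ) ^ (-(1 / 2) : ℝ)
                * BernsteinSimplex.intV (BernsteinSimplex.jointCDF μ)
            + (m n : ℝ) ^ (-2 : ℝ) * BernsteinSimplex.intBSq (BernsteinSimplex.jointCDF μ)
            + r₁ n + r₂ n) ∧
    (0 < BernsteinSimplex.intBSq (BernsteinSimplex.jointCDF μ) →
      0 < BernsteinSimplex.intV (BernsteinSimplex.jointCDF μ) ∧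
      -- `m_opt` is the unique minimiser of the expansion over all real bandwidths
      (∀ n : ℕ, 1 ≤ n → 0 < BernsteinSimplex.mOpt (BernsteinSimplex.jointCDF μ) n ∧
        ∀ t : ℝ, 0 < t → t ≠ BernsteinSimplex.mOpt (BernsteinSimplex.jointCDF μ) n →
          BernsteinSimplex.leadingMISE (BernsteinSimplex.jointCDF μ) n
              (BernsteinSimplex.mOpt (BernsteinSimplex.jointCDF μ) n)
            < BernsteinSimplex.leadingMISE (BernsteinSimplex.jointCDF μ) n t) ∧
      -- the asymptotically optimal integer bandwidths are exactly those equivalent to `m_opt`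
      (∀ m : ℕ → ℕ, (∀ n, 1 ≤ m n) →
        (BernsteinSimplex.AsymptoticallyOptimal
            (BernsteinSimplex.MISE P X (BernsteinSimplex.jointCDF μ))
            (fun n : ℕ => (n : ℝ) ^ (-(4 / 3) : ℝ)) m ↔
          Tendsto (fun n => (m n : ℝ) / BernsteinSimplex.mOpt (BernsteinSimplex.jointCDF μ) n)
            atTop (𝓝 1))) ∧
      -- the MISE at the optimal bandwidth
      (∀ m : ℕ → ℕ,
        Tendsto (fun n => (m n : ℝ) / BernsteinSimplex.mOpt (BernsteinSimplex.jointCDF μ) n)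
          atTop (𝓝 1) →
        (fun n : ℕ => BernsteinSimplex.MISE P X (BernsteinSimplex.jointCDF μ) n (m n)
          - ((n : ℝ)⁻¹ * BernsteinSimplex.intSigmaSq (BernsteinSimplex.jointCDF μ)
            - (n : ℝ) ^ (-(4 / 3) : ℝ) * (3 / 4)
              * (BernsteinSimplex.intV (BernsteinSimplex.jointCDF μ) ^ 4
                  / (4 * BernsteinSimplex.intBSq (BernsteinSimplex.jointCDF μ))) ^ (1 / 3 : ℝ)))
          =o[atTop] fun n : ℕ => (n : ℝ) ^ (-(4 / 3) : ℝ))) := by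
  have h01 : ∀ y, 0 ≤ BernsteinSimplex.jointCDF μ y ∧ BernsteinSimplex.jointCDF μ y ≤ 1 :=
    BernsteinSimplex.jointCDF_mem
  have hR : ∀ n, 1 ≤ n → ∀ k, BernsteinSimplex.MISE P X (BernsteinSimplex.jointCDF μ) n k = _ :=
    fun n hn k => BernsteinSimplex.MISE_eq hF.continuousOn hlaw hindep hn k
  have hW := BernsteinSimplex.tendsto_integral_bernsteinVar hF h01
  have hb := BernsteinSimplex.tendsto_integral_bernsteinPoly_sub_sq hF
  refine ⟨fun m hm => BernsteinSimplex.exists_isLittleO_expansion hR hW hb hm, fun hB => ?_⟩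
  have hV := BernsteinSimplex.intV_pos hF (BernsteinSimplex.monotone_jointCDF μ) hB
  have hbpos := fun k hk =>
    BernsteinSimplex.integral_bernsteinPoly_sub_sq_pos hF hB (m := k) hk
  exact ⟨hV, fun n hn => ⟨BernsteinSimplex.optBandwidth_pos hV hB hn,
      fun t ht hne => BernsteinSimplex.expansion_optBandwidth_lt hV hB hn ht hne⟩,
    fun m hm => ⟨BernsteinSimplex.tendsto_of_asymptoticallyOptimal hV hB hR hW hb hbpos hm,
      BernsteinSimplex.asymptoticallyOptimal_of_tendsto hV hB hR hW hb hbpos⟩,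
    fun m hm => BernsteinSimplex.risk_optBandwidth_isLittleO hV hB hR hW hb hm⟩
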